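/- **Setting.** Let $0<p\le\infty$ and let $\nu$ be a Borel measure on $\mathbb R$ that is positive on every nonempty open set (for instance Lebesgue measure). Let $\mathbb U$ be the set of continuous, bounded, increasing (i.e. non-decreasing) functions $u:\mathbb R\to\mathbb R$ with $u\in\mathcal L^p(\nu)$, with the topology of $\mathcal L^p(\nu)$-convergence. Let $\xi_1,\dots,\xi_T$ be random vectors on a probability space $(\Omega,\mathcal F,\mathbb P)$, $\xi_t$ with values in $\mathbb R^{d_t}$; write $\xi_{[t]}=(\xi_1,\dots,\xi_t)$, let $\mathcal F_t$ be the $\sigma$-algebra generated by $\xi_{[t]}$ ($\mathcal F_0$ is trivial and $\xi_{[0]}$ is the empty history), and let the reward $Z_t:\Omega\to\mathbb R$ be $\mathcal F_t$-measurable, $t=1,\dots,T$. For every $t\le T$ and every history $y\in\mathbb R^{d_1}\times\dots\times\mathbb R^{d_{t-1}}$ let $\mathcal U_t(y)\subset\mathbb U$ be compact, and let $y\mapsto\mathcal U_t(y)$ be a random set, i.e. $\{y:\mathcal U_t(y)\cap G\neq\emptyset\}$ is Borel for every open $G\subset\mathbb U$. The ambiguity set is $$\mathcal U=\{\vec{\mathfrak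 u}=(\mathfrak u_1,\dots,\mathfrak u_T):\ \mathfrak u_t(z,y)\text{ is jointly Borel measurable and }\mathfrak u_t(\cdot,y)\in\mathcal U_t(y)\text{ for all }y,\ t=1,\dots,T\}.$$ Assume that some $\vec{\mathfrak u}\in\mathcal U$ has finite expected utilities: $\mathbb E|\mathfrak u_t(Z_t,\xi_{[t-1]})|<\infty$ for $t=1,\dots,T$ (in particular $\mathcal U\ne\emptyset$). Expectations of extended-real functions are $\mathbb E[Y]=\mathbb E[Y^+]-\mathbb E[Y^-]\in[-\infty,\infty]$, with the convention $\infty-\infty=+\infty$. Conditional expectations $\mathbb E_{|\mathcal F_{t-1}}$ at a history $\xi_{[t-1]}=y$ are taken with respect to a regular conditional distribution of $(Z_t,\xi_t)$ given $\xi_{[t-1]}=y$, so that the infima below are pointwise infima. For a set $\mathcal V$ of utility sequences, a history $y=(y_1,\dots,y_{t-1})$ and earlier utilities $u_1,\dots,u_{t-1}\in\mathbb U$, the stage set of $\mathcal V$ at $y$ is $$\mathcal V_t(u_1,\dots,u_{t-1};y)=\{\mathfrak v_t(\cdot,y):\ \vec{\mathfrak v}\in\mathcal V,\ \mathfrak v_s(\cdot,(y_1,\dots,y_{s-1}))=u_s\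 \text{for } s<t\}.$$ $\mathcal V$ is called rectangular (for $\xi$ and $Z$) if it is nonempty and $$\inf_{\vec{\mathfrak u}\in\mathcal V}\mathbb E\Big[\sum_{t=1}^T\mathfrak u_t(Z_t,\xi_{[t-1]})\Big]=\inf_{u_1}\mathbb E_{|\mathcal F_0}\Big[u_1(Z_1)+\inf_{u_2}\mathbb E_{|\mathcal F_1}\Big[u_2(Z_2)+\dots+\inf_{u_T}\mathbb E_{|\mathcal F_{T-1}}[u_T(Z_T)]\cdots\Big]\Big],$$ where the infimum at stage $t$ is over $u_t\in\mathcal V_t(u_1,\dots,u_{t-1};\xi_{[t-1]})$. **Proposition.** The ambiguity set $\mathcal U$ is rectangular. Moreover its stage sets are the given sets: for every $\vec{\mathfrak u}\in\mathcal U$, every $t$ and every history $y=(y_1,\dots,y_{t-1})$, the stage set of $\mathcal U$ at $y$ after the earlier utilities $\mathfrak u_s(\cdot,(y_1,\dots,y_{s-1}))$, $s<t$, is $\mathcal U_t(y)$. Consequently $$\inf_{\vec{\mathfrak u}\in\mathcal U}\mathbb E\Big[\sum_{t=1}^T\mathfrak u_t(Z_t,\xi_{[t-1]})\Big]=\inf_{u_1\in\mathcal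 U_1}\mathbb E_{|\mathcal F_0}\Big[u_1(Z_1)+\inf_{u_2\in\mathcal U_2(\xi_{[1]})}\mathbb E_{|\mathcal F_1}\Big[u_2(Z_2)+\dots+\inf_{u_T\in\mathcal U_T(\xi_{[T-1]})}\mathbb E_{|\mathcal F_{T-1}}[u_T(Z_T)]\cdots\Big]\Big].$$ -/

import Mathlib

open MeasureTheory ProbabilityTheory
open scoped ENNReal

noncomputable section

/-- The class `𝕌` of utility functions: continuous, bounded, (weakly) increasing real functions of
one real variable that are `p`-integrable with respect to the reference measure `ν` on `ℝ`
(Lebesgue measure being the basic example). -/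
structure Utility (p : ℝ≥0∞) (ν : Measure ℝ) where
  toFun : ℝ → ℝ
  continuous_toFun : Continuous toFun
  bounded_toFun : ∃ C : ℝ, ∀ x, |toFun x| ≤ C
  monotone_toFun : Monotone toFun
  memLp_toFun : MemLp toFun p ν

instance Utility.instCoeFun (p : ℝ≥0∞) (ν : Measure ℝ) :
    CoeFun (Utility p ν) (fun _ => ℝ → ℝ) := ⟨Utility.toFun⟩

/-- The topology of `L^p(ν)`-convergence on the class of utility functions: a set is open if with
each of its points it contains an `L^p(ν)`-ball around that point. -/
instance Utility.instTopologicalSpace (p : ℝ≥0∞) (ν : Measure ℝ) :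
    TopologicalSpace (Utility p ν) where
  IsOpen G := ∀ u ∈ G, ∃ ε : ℝ≥0∞, 0 < ε ∧
    ∀ v : Utility p ν, eLpNorm (fun x => v x - u x) p ν < ε → v ∈ G
  isOpen_univ := fun _ _ => ⟨1, one_pos, fun _ _ => Set.mem_univ _⟩
  isOpen_inter := by
    rintro G₁ G₂ h₁ h₂ u ⟨hu₁, hu₂⟩
    obtain ⟨ε₁, hε₁, hb₁⟩ := h₁ u hu₁
    obtain ⟨ε₂, hε₂, hb₂⟩ := h₂ u hu₂
    exact ⟨min ε₁ ε₂, lt_min hε₁ hε₂, fun v hv =>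
      ⟨hb₁ v (lt_of_lt_of_le hv (min_le_left _ _)), hb₂ v (lt_of_lt_of_le hv (min_le_right _ _))⟩⟩
  isOpen_sUnion := by
    rintro S hS u ⟨G, hG, hu⟩
    obtain ⟨ε, hε, hb⟩ := hS G hG u hu
    exact ⟨ε, hε, fun v hv => ⟨G, hG, hb v hv⟩⟩

/-- Histories `(y_0, …, y_{t-1})` of length `t`, where `y_i ∈ ℝ^{d i}`. Stages are counted
from `0`, so that `Hist d t` carries the information available before the decision at
stage `t`; `Hist d 0` has exactly one element. -/
abbrev Hist (d : ℕ → ℕ) (t : ℕ) : Type :=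
  ∀ i : Fin t, EuclideanSpace ℝ (Fin (d i))

/-- The part of length `s ≤ t` of a history of length `t`. -/
def Hist.past {d : ℕ → ℕ} {t : ℕ} (h : Hist d t) (s : ℕ) (hs : s ≤ t) : Hist d s :=
  fun i => h (Fin.castLE hs i)

/-- The history `h` followed by the new observation `y`. -/
def Hist.extend {d : ℕ → ℕ} {t : ℕ} (h : Hist d t) (y : EuclideanSpace ℝ (Fin (d t))) :
    Hist d (t + 1) :=
  Fin.snoc (α := fun i : Fin (t + 1) => EuclideanSpace ℝ (Fin (d i))) h y

/-- The observed history of length `t` of the data `ξ_0, ξ_1, …`. -/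
def history {Ω : Type*} {d : ℕ → ℕ} (ξ : ∀ i : ℕ, Ω → EuclideanSpace ℝ (Fin (d i)))
    (t : ℕ) (ω : Ω) : Hist d t :=
  fun i => ξ i ω

/-- Sequences of state-dependent utility functions: for each stage `t` and each history of
length `t` a utility function. -/
abbrev UtilitySeq (p : ℝ≥0∞) (ν : Measure ℝ) (d : ℕ → ℕ) : Type :=
  ∀ t : ℕ, Hist d t → Utility p ν

/-- Measurability of a set-valued map (a random set). -/
def IsRandomSet {α β : Type*} [MeasurableSpace α] [TopologicalSpace β] (U : α → Set β) : Prop :=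
  ∀ G : Set β, IsOpen G → MeasurableSet {a | (U a ∩ G).Nonempty}

/-- The ambiguity set: all sequences of jointly measurable state-dependent utility functions
`𝔲_t(z, h)`, `t < T`, with `𝔲_t(·, h) ∈ U t h` for every history `h`. -/
def ambiguitySet {p : ℝ≥0∞} {ν : Measure ℝ} {d : ℕ → ℕ} (T : ℕ)
    (U : ∀ t : ℕ, Hist d t → Set (Utility p ν)) : Set (UtilitySeq p ν d) :=
  {𝔲 | ∀ t < T, Measurable (fun q : Hist d t × ℝ => 𝔲 t q.1 q.2) ∧ ∀ h : Hist d t, 𝔲 t h ∈ U t h}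

/-- The set of utility functions `u` for stage `t` at history `h` which, after the earlier utility
functions `pre 0, …, pre (t-1)` used along `h`, can be continued to a sequence in `𝒰`. -/
def stageSet {p : ℝ≥0∞} {ν : Measure ℝ} {d : ℕ → ℕ} (𝒰 : Set (UtilitySeq p ν d))
    (t : ℕ) (pre : Fin t → Utility p ν) (h : Hist d t) : Set (Utility p ν) :=
  {u | ∃ 𝔲 ∈ 𝒰, (∀ s : Fin t, 𝔲 s (h.past s s.isLt.le) = pre s) ∧ 𝔲 t h = u}

open Classical in
/-- Expectation of an extended-real-valued function, `E[f] = E[f⁺] - E[f⁻]`, with the convention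
`∞ - ∞ = +∞` (as usual in minimization). -/
def extExpectation {α : Type*} [MeasurableSpace α] (μ : Measure α) (f : α → EReal) : EReal :=
  if ∫⁻ x, (f x).toENNReal ∂μ = ⊤ then ⊤
  else ((∫⁻ x, (f x).toENNReal ∂μ : ℝ≥0∞) : EReal) - ((∫⁻ x, (-f x).toENNReal ∂μ : ℝ≥0∞) : EReal)

/-- The nested value over the `n` stages `t, …, t + n - 1`, given the earlier utility functions
`pre` and the history `h` of length `t`; the infimum at stage `t` is over `S t pre h`:
`inf_u E[u(Z_t) + (nested value from stage t + 1 on) | history = h]`.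
The conditional expectation is taken with respect to the regular conditional distribution of
`(Z_t, ξ_t)` given the history of length `t`. -/
def nestedValue {Ω : Type*} [MeasurableSpace Ω] (P : Measure Ω) [IsProbabilityMeasure P]
    {p : ℝ≥0∞} {ν : Measure ℝ} {d : ℕ → ℕ}
    (ξ : ∀ i : ℕ, Ω → EuclideanSpace ℝ (Fin (d i))) (Z : ℕ → Ω → ℝ)
    (S : ∀ t : ℕ, (Fin t → Utility p ν) → Hist d t → Set (Utility p ν)) :
    ℕ → ∀ t : ℕ, (Fin t → Utility p ν) → Hist d t → EReal
  | 0, _, _, _ => 0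
  | n + 1, t, pre, h =>
      ⨅ u ∈ S t pre h,
        extExpectation (condDistrib (fun ω => (Z t ω, ξ t ω)) (history ξ t) P h)
          (fun q : ℝ × EuclideanSpace ℝ (Fin (d t)) =>
            ((u q.1 : ℝ) : EReal) +
              nestedValue P ξ Z S n (t + 1) (Fin.snoc (α := fun _ => Utility p ν) pre u)
                (h.extend q.2))

/-- The worst-case total expected utility over the sequences in `𝒰`, taken jointly. -/
def worstCase {Ω : Type*} [MeasurableSpace Ω] (P : Measure Ω)
    {p : ℝ≥0∞} {ν : Measure ℝ} {d : ℕ → ℕ}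
    (ξ : ∀ i : ℕ, Ω → EuclideanSpace ℝ (Fin (d i))) (Z : ℕ → Ω → ℝ) (T : ℕ)
    (𝒰 : Set (UtilitySeq p ν d)) : EReal :=
  ⨅ 𝔲 ∈ 𝒰, extExpectation P
    (fun ω => ((∑ t ∈ Finset.range T, 𝔲 t (history ξ t ω) (Z t ω) : ℝ) : EReal))

/-- Rectangularity of a set `𝒰` of utility sequences, for the data `ξ` and the rewards `Z`:
`𝒰` is nonempty and the joint worst case equals the nested one over the stage sets of `𝒰`. -/
def IsRectangular {Ω : Type*} [MeasurableSpace Ω] (P : Measure Ω) [IsProbabilityMeasure P]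
    {p : ℝ≥0∞} {ν : Measure ℝ} {d : ℕ → ℕ}
    (ξ : ∀ i : ℕ, Ω → EuclideanSpace ℝ (Fin (d i))) (Z : ℕ → Ω → ℝ) (T : ℕ)
    (𝒰 : Set (UtilitySeq p ν d)) : Prop :=
  𝒰.Nonempty ∧
    worstCase P ξ Z T 𝒰 = nestedValue P ξ Z (stageSet 𝒰) T 0 Fin.elim0 (fun i => i.elim0)

end

/-! Write m_t(h) for the infimum of E[u(Z_t) | h] over u in U_t(h) (`Utility.stageInf`). A member of
the ambiguity set can be changed at a single history without losing joint measurability, so earlier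
choices never constrain later ones and the stage sets are the given sets (`stageSet_ambiguitySet`).
Utilities are bounded and the continuation value does not depend on the current choice, so each
infimum splits off its own stage, and the nested value is the sum of the E[m_t]
(`nestedValue_zero_eq_sum`). The sequence with finite expected utilities makes every m_t⁺
integrable, hence E[m_t] < +∞.

The joint worst case is at most this sum (`worstCase_le_sum`), because near-optimal selections can
be chosen at each stage separately. To find them, note that monotonicity makes point evaluation
continuous for L^p(ν)-convergence. Sampling on a dense sequence therefore turns the sets U_t(h) into
compact random sets in ℝ^ℕ, where lexicographic minimization selects measurably. Dominated
convergence and truncation of moments then give integrable selections whose conditional expectations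
decrease to m_t.

The reverse bound (`sum_le_extExpectation`) cannot be taken term by term, since a sum may be
integrable while its terms are not. The increments 𝔲_t - m_t have nonnegative conditional mean, and
their partial sums depend only on the history because Z_t is adapted. Such a generalized
submartingale has nonnegative terminal mean once its terminal positive part is integrable
(`integrable_sum_and_integral_nonneg`). If the total utility has nonintegrable positive part, its
expectation is +∞ by convention. -/

open Filter Topology

/-! ### Point evaluation and sampling of utility functions -/

namespace Utility

variable {p : ℝ≥0∞} {ν : Measure ℝ}

theorem eLpNorm_indicator_pos [ν.IsOpenPosMeasure] (hp : 0 < p) {s : Set ℝ} (hs : IsOpen s)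
    (hne : s.Nonempty) {c : ℝ} (hc : 0 < c) :
    0 < eLpNorm (s.indicator fun _ => c) p ν := by
  rw [eLpNorm_indicator_const' hs.measurableSet (hs.measure_pos ν hne).ne' hp.ne']
  refine ENNReal.mul_pos (by simpa using hc.ne') ?_
  rw [Ne, ENNReal.rpow_eq_zero_iff]
  rintro (h | h)
  · exact (hs.measure_pos ν hne).ne' h.1
  · exact absurd h.2 (not_lt.2 (by positivity))

theorem eLpNorm_indicator_le_sub (s : Set ℝ) {c : ℝ} (hc : 0 < c) {f : ℝ → ℝ}
    (h : ∀ x ∈ s, c ≤ |f x|) : eLpNorm (s.indicator fun _ => c) p ν ≤ eLpNorm f p ν := by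
  refine eLpNorm_mono fun x => ?_
  by_cases hx : x ∈ s
  · simpa [hx, abs_of_pos hc] using h x hx
  · simp [hx]

/-- Suppose u(x) > a but v(x) ≤ a. Then v ≤ a to the left of x, while u stays above the midpoint of
a and u(x) on some (x - δ, x). The L^p distance is thus at least that of a fixed positive step on a
nonempty open interval. The other half-line is symmetric, on the right of x. -/
theorem continuous_eval [ν.IsOpenPosMeasure] (hp : 0 < p) (x : ℝ) :
    Continuous fun u : Utility p ν => u x := by
  rw [OrderTopology.continuous_iff]
  refine fun a => ⟨fun u hu => ?_, fun u hu => ?_⟩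
  · simp only [Set.mem_preimage, Set.mem_Ioi] at hu
    have hc : 0 < (u x - a) / 2 := by linarith
    have h1 : ∀ᶠ y in 𝓝 x, u x - (u x - a) / 2 < u y :=
      u.continuous_toFun.continuousAt.eventually_const_lt (by linarith)
    obtain ⟨δ, hδ, h2⟩ := Metric.eventually_nhds_iff.1 h1
    refine ⟨_, eLpNorm_indicator_pos (ν := ν) hp (isOpen_Ioo (a := x - δ) (b := x))
      (Set.nonempty_Ioo.2 (by linarith)) hc, fun v hv => ?_⟩
    by_contra hva
    simp only [Set.mem_preimage, Set.mem_Ioi, not_lt] at hva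
    refine absurd hv (not_lt.2 (eLpNorm_indicator_le_sub _ hc fun y hy => ?_))
    have h3 := h2 (y := y) (by rw [Real.dist_eq, abs_lt]; constructor <;> linarith [hy.1, hy.2])
    have h4 := v.monotone_toFun hy.2.le
    rw [abs_sub_comm]
    exact le_trans (by linarith) (le_abs_self _)
  · simp only [Set.mem_preimage, Set.mem_Iio] at hu
    have hc : 0 < (a - u x) / 2 := by linarith
    have h1 : ∀ᶠ y in 𝓝 x, u y < u x + (a - u x) / 2 :=
      u.continuous_toFun.continuousAt.eventually_lt_const (by linarith)
    obtain ⟨δ, hδ, h2⟩ := Metric.eventually_nhds_iff.1 h1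
    refine ⟨_, eLpNorm_indicator_pos (ν := ν) hp (isOpen_Ioo (a := x) (b := x + δ))
      (Set.nonempty_Ioo.2 (by linarith)) hc, fun v hv => ?_⟩
    by_contra hva
    simp only [Set.mem_preimage, Set.mem_Iio, not_lt] at hva
    refine absurd hv (not_lt.2 (eLpNorm_indicator_le_sub _ hc fun y hy => ?_))
    have h3 := h2 (y := y) (by rw [Real.dist_eq, abs_lt]; constructor <;> linarith [hy.1, hy.2])
    have h4 := v.monotone_toFun hy.1.le
    exact le_trans (by linarith) (le_abs_self _)

/-- The values of a utility function along a dense sequence of reals. -/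
noncomputable def sample (u : Utility p ν) : ℕ → ℝ := fun n => u (TopologicalSpace.denseSeq ℝ n)

theorem continuous_sample [ν.IsOpenPosMeasure] (hp : 0 < p) :
    Continuous (sample : Utility p ν → ℕ → ℝ) :=
  continuous_pi fun _ => continuous_eval hp _

theorem exists_denseSeq_mem_Ioo {a b : ℝ} (h : a < b) :
    ∃ n, a < TopologicalSpace.denseSeq ℝ n ∧ TopologicalSpace.denseSeq ℝ n < b := by
  obtain ⟨_, ⟨n, rfl⟩, hx⟩ := (TopologicalSpace.denseRange_denseSeq ℝ).exists_between h
  exact ⟨n, hx⟩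

/-- Convergence along the dense sequence implies pointwise convergence. -/
theorem tendsto_of_tendsto_sample {u : Utility p ν} {v : ℕ → Utility p ν}
    (h : Tendsto (fun j => sample (v j)) atTop (𝓝 (sample u))) (x : ℝ) :
    Tendsto (fun j => v j x) atTop (𝓝 (u x)) := by
  rw [tendsto_pi_nhds] at h
  refine tendsto_order.2 ⟨fun a ha => ?_, fun a ha => ?_⟩
  · obtain ⟨δ, hδ, h2⟩ := Metric.eventually_nhds_iff.1
      (u.continuous_toFun.continuousAt.eventually_const_lt ha)
    -- A sample point just left of x, where u still exceeds a; monotonicity of each `v j` carries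
    -- the bound on to x.
    obtain ⟨n, hn1, hn2⟩ := exists_denseSeq_mem_Ioo (a := x - δ) (b := x) (by linarith)
    have h3 := h2 (y := TopologicalSpace.denseSeq ℝ n)
      (by rw [Real.dist_eq, abs_lt]; constructor <;> linarith)
    filter_upwards [(h n).eventually_const_lt h3] with j hj
    exact hj.trans_le ((v j).monotone_toFun hn2.le)
  · obtain ⟨δ, hδ, h2⟩ := Metric.eventually_nhds_iff.1
      (u.continuous_toFun.continuousAt.eventually_lt_const ha)
    obtain ⟨n, hn1, hn2⟩ := exists_denseSeq_mem_Ioo (a := x) (b := x + δ) (by linarith)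
    have h3 := h2 (y := TopologicalSpace.denseSeq ℝ n)
      (by rw [Real.dist_eq, abs_lt]; constructor <;> linarith)
    filter_upwards [(h n).eventually_lt_const h3] with j hj
    exact ((v j).monotone_toFun hn1.le).trans_lt hj

/-- For a monotone continuous u, u(x) < c exactly when u(q) < c at some sample point q > x. The
samples thus determine each evaluation measurably, and continuity in x gives joint measurability. -/
theorem measurable_uncurry {α : Type*} [MeasurableSpace α] {v : α → Utility p ν}
    (h : Measurable fun a => sample (v a)) : Measurable fun q : α × ℝ => v q.1 q.2 := by
  have hx : ∀ x, Measurable fun a => v a x := by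
    refine fun x => measurable_of_Iio fun c => ?_
    have : (fun a => v a x) ⁻¹' Set.Iio c = ⋃ n ∈ {n | x < TopologicalSpace.denseSeq ℝ n},
        {a | sample (v a) n < c} := by
      ext a
      simp only [Set.mem_preimage, Set.mem_Iio, Set.mem_iUnion, Set.mem_ofPred_eq, exists_prop]
      constructor
      · intro ha
        obtain ⟨δ, hδ, h2⟩ := Metric.eventually_nhds_iff.1
          ((v a).continuous_toFun.continuousAt.eventually_lt_const ha)
        obtain ⟨n, hn1, hn2⟩ := exists_denseSeq_mem_Ioo (a := x) (b := x + δ) (by linarith)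
        exact ⟨n, hn1, h2 (by rw [Real.dist_eq, abs_lt]; constructor <;> linarith)⟩
      · rintro ⟨n, hn, h2⟩
        exact ((v a).monotone_toFun hn.le).trans_lt h2
    rw [this]
    exact MeasurableSet.biUnion (Set.to_countable _) fun n _ =>
      measurableSet_lt ((measurable_pi_apply n).comp h) measurable_const
  have := measurable_uncurry_of_continuous_of_measurable (u := fun x a => v a x)
    (fun a => (v a).continuous_toFun) hx
  exact this.comp measurable_swap

theorem measurable_sample {α : Type*} [MeasurableSpace α] {v : α → Utility p ν}
    (h : Measurable fun q : α × ℝ => v q.1 q.2) : Measurable fun a => sample (v a) :=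
  measurable_pi_lambda _ fun _ => h.comp (measurable_id.prodMk measurable_const)

theorem abs_le_of_sample {u : Utility p ν} {k : ℝ} (h : ∀ n, |sample u n| ≤ k) (x : ℝ) :
    |u x| ≤ k := by
  have hcl : IsClosed {y | |u y| ≤ k} :=
    isClosed_le u.continuous_toFun.abs continuous_const
  have : closure (Set.range (TopologicalSpace.denseSeq ℝ)) ⊆ {y | |u y| ≤ k} :=
    hcl.closure_subset_iff.2 (by rintro _ ⟨n, rfl⟩; exact h n)
  exact this ((TopologicalSpace.denseRange_denseSeq ℝ) x)

theorem integrable_comp {β : Type*} [MeasurableSpace β] (μ : Measure β) [IsFiniteMeasure μ]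
    {g : β → ℝ} (hg : Measurable g) (u : Utility p ν) : Integrable (fun b => u (g b)) μ := by
  obtain ⟨C, hC⟩ := u.bounded_toFun
  exact Integrable.of_bound (u.continuous_toFun.measurable.comp hg).aestronglyMeasurable C
    (ae_of_all _ fun b => hC _)

end Utility

/-! ### Measurable selections from compact-valued random sets -/

/-- For a compact-valued random set in a metrizable space, the set of points whose value meets a
given closed set is measurable. -/
theorem IsRandomSet.measurableSet_inter_closed {α X : Type*} [MeasurableSpace α]
    [TopologicalSpace X] [TopologicalSpace.MetrizableSpace X] {Γ : α → Set X}
    (h : IsRandomSet Γ) (hc : ∀ a, IsCompact (Γ a)) {F : Set X} (hF : IsClosed F) :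
    MeasurableSet {a | (Γ a ∩ F).Nonempty} := by
  let _ := TopologicalSpace.metrizableSpaceMetric X
  have : {a | (Γ a ∩ F).Nonempty} =
      ⋂ n : ℕ, {a | (Γ a ∩ Metric.thickening (1 / ((n : ℝ) + 1)) F).Nonempty} := by
    ext a
    simp only [Set.mem_ofPred_eq, Set.mem_iInter]
    constructor
    · rintro ⟨x, hx, hxF⟩ n
      exact ⟨x, hx, Metric.self_subset_thickening (by positivity) F hxF⟩
    · intro hn
      by_contra hne
      rw [Set.not_nonempty_iff_eq_empty, ← Set.disjoint_iff_inter_eq_empty] at hne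
      -- A compact set disjoint from a closed set is a positive distance away, hence misses a small
      -- thickening.
      obtain ⟨δ, hδ, hd⟩ := hne.exists_thickenings (hc a) hF
      obtain ⟨n, hnδ⟩ := exists_nat_one_div_lt hδ
      obtain ⟨x, hx, hxF⟩ := hn n
      exact Set.disjoint_left.1 hd (Metric.self_subset_thickening hδ _ hx)
        (Metric.thickening_mono hnδ.le F hxF)
  rw [this]
  exact MeasurableSet.iInter fun n => h _ Metric.isOpen_thickening

/-- One step of the lexicographic selection: minimizing a coordinate over a compact-valued
measurable multifunction. -/
theorem exists_measurable_min_coordinate {α : Type*} [MeasurableSpace α] {Γ : α → Set (ℕ → ℝ)}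
    (hc : ∀ a, IsCompact (Γ a)) (hne : ∀ a, (Γ a).Nonempty)
    (hm : ∀ F, IsClosed F → MeasurableSet {a | (Γ a ∩ F).Nonempty}) (n : ℕ) :
    ∃ g : α → ℝ, Measurable g ∧ (∀ a, ∀ x ∈ Γ a, g a ≤ x n) ∧
      (∀ a, (Γ a ∩ {x | x n ≤ g a}).Nonempty) ∧
      ∀ F, IsClosed F → MeasurableSet {a | (Γ a ∩ {x | x n ≤ g a} ∩ F).Nonempty} := by
  have hmin : ∀ a, ∃ x ∈ Γ a, ∀ y ∈ Γ a, x n ≤ y n := fun a =>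
    (hc a).exists_isMinOn (hne a) (continuous_apply n).continuousOn
  choose x hx hxm using hmin
  have hcl : ∀ r : ℝ, IsClosed {y : ℕ → ℝ | y n ≤ r} := fun r =>
    isClosed_le (continuous_apply n) continuous_const
  have hg : Measurable fun a => x a n := by
    refine measurable_of_Iic fun r => ?_
    convert hm _ (hcl r) using 1
    ext a
    exact ⟨fun h => ⟨x a, hx a, h⟩, fun ⟨y, hy, hyr⟩ => (hxm a y hy).trans hyr⟩
  refine ⟨fun a => x a n, hg, hxm, fun a => ⟨x a, hx a, le_refl (x a n)⟩, fun F hF => ?_⟩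
  -- The threshold depends on a; rational thresholds above it make the test sets constant. Nothing
  -- is lost, since the coordinate attains its minimum on the compact set `Γ a ∩ F`.
  have : {a | (Γ a ∩ {y | y n ≤ x a n} ∩ F).Nonempty} =
      ⋂ r : ℚ, {a | (r : ℝ) ≤ x a n} ∪ {a | (Γ a ∩ ({y | y n ≤ (r : ℝ)} ∩ F)).Nonempty} := by
    ext a
    simp only [Set.mem_ofPred_eq, Set.mem_iInter, Set.mem_union]
    constructor
    · rintro ⟨y, ⟨hy, hyn⟩, hyF⟩ r
      by_cases hr : (r : ℝ) ≤ x a n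
      · exact Or.inl hr
      · exact Or.inr ⟨y, hy, le_trans hyn (not_le.1 hr).le, hyF⟩
    · intro h
      have hF' : (Γ a ∩ F).Nonempty := by
        obtain ⟨r, hr⟩ := exists_rat_gt (x a n)
        obtain ⟨y, hy, -, hyF⟩ := (h r).resolve_left (not_le.2 hr)
        exact ⟨y, hy, hyF⟩
      obtain ⟨y, hy, hymin⟩ := ((hc a).inter_right hF).exists_isMinOn hF'
        (continuous_apply n).continuousOn
      refine ⟨y, ⟨hy.1, ?_⟩, hy.2⟩
      by_contra hlt
      obtain ⟨r, hr1, hr2⟩ := exists_rat_btwn (lt_of_not_ge (show ¬ y n ≤ x a n from hlt))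
      obtain ⟨w, hw, hwr, hwF⟩ := (h r).resolve_left (not_le.2 hr1)
      exact absurd (hymin ⟨hw, hwF⟩) (not_le.2 (lt_of_le_of_lt hwr hr2))
  rw [this]
  exact MeasurableSet.iInter fun r =>
    (measurableSet_le measurable_const hg).union (hm _ ((hcl r).inter hF))

/-- A compact-valued measurable multifunction into `ℕ → ℝ` has a measurable selection. -/
theorem exists_measurable_selection {α : Type*} [MeasurableSpace α] {Γ : α → Set (ℕ → ℝ)}
    (hc : ∀ a, IsCompact (Γ a)) (hne : ∀ a, (Γ a).Nonempty)
    (hm : ∀ F, IsClosed F → MeasurableSet {a | (Γ a ∩ F).Nonempty}) :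
    ∃ f : α → ℕ → ℝ, Measurable f ∧ ∀ a, f a ∈ Γ a := by
  let S := {Δ : α → Set (ℕ → ℝ) // (∀ a, IsCompact (Δ a)) ∧ (∀ a, (Δ a).Nonempty) ∧
    ∀ F, IsClosed F → MeasurableSet {a | (Δ a ∩ F).Nonempty}}
  have step : ∀ (n : ℕ) (Δ : S), ∃ (Δ' : S) (g : α → ℝ), Measurable g ∧
      (∀ a, Δ'.1 a ⊆ Δ.1 a) ∧ ∀ a, ∀ x ∈ Δ'.1 a, x n = g a := by
    rintro n ⟨Δ, h1, h2, h3⟩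
    obtain ⟨g, hg, hle, hne', hm'⟩ := exists_measurable_min_coordinate h1 h2 h3 n
    exact ⟨⟨fun a => Δ a ∩ {x | x n ≤ g a},
      fun a => (h1 a).inter_right (isClosed_le (continuous_apply n) continuous_const),
      hne', hm'⟩, g, hg, fun a => Set.inter_subset_left,
      fun a x hx => le_antisymm hx.2 (hle a x hx.1)⟩
  choose next g hg hsub heq using step
  let D : ℕ → S := fun n => Nat.rec ⟨Γ, hc, hne, hm⟩ (fun k Δ => next k Δ) n
  refine ⟨fun a n => g n (D n) a, measurable_pi_lambda _ fun n => hg n (D n), fun a => ?_⟩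
  obtain ⟨x, hx⟩ := IsCompact.nonempty_iInter_of_sequence_nonempty_isCompact_isClosed
    (fun n => (D n).1 a) (fun n => hsub n (D n) a) (fun n => (D n).2.2.1 a) ((D 0).2.1 a)
    (fun n => ((D n).2.1 a).isClosed)
  rw [Set.mem_iInter] at hx
  -- Step n freezes coordinate n, so the nested compact sets shrink to one point, whose coordinates
  -- are the measurable minima.
  have : (fun n => g n (D n) a) = x := funext fun n => (heq n (D n) a x (hx (n + 1))).symm
  exact Set.mem_of_eq_of_mem this (hx 0)

/-- A compact-valued random set in `ℕ → ℝ` has countably many measurable selections which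
approximate, within a closed set `B`, each point of its values that lies in `B`. -/
theorem exists_dense_measurable_selections {α : Type*} [MeasurableSpace α]
    {Γ : α → Set (ℕ → ℝ)} (h : IsRandomSet Γ) (hc : ∀ a, IsCompact (Γ a))
    {f₀ : α → ℕ → ℝ} (hf₀ : Measurable f₀) (hf₀Γ : ∀ a, f₀ a ∈ Γ a)
    {B : Set (ℕ → ℝ)} (hB : IsClosed B) :
    ∃ f : ℕ → α → ℕ → ℝ, (∀ i, Measurable (f i)) ∧ (∀ i a, f i a ∈ Γ a) ∧
      ∀ a, ∀ x ∈ Γ a ∩ B, ∃ i : ℕ → ℕ, (∀ j, f (i j) a ∈ B) ∧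
        Tendsto (fun j => f (i j) a) atTop (𝓝 x) := by
  classical
  let _ := TopologicalSpace.metrizableSpaceMetric (ℕ → ℝ)
  let F : ℕ × ℕ → Set (ℕ → ℝ) := fun q =>
    Metric.closedBall (TopologicalSpace.denseSeq (ℕ → ℝ) q.1) (1 / ((q.2 : ℝ) + 1))
  have hsel : ∀ q : ℕ × ℕ, ∃ f : α → ℕ → ℝ, Measurable f ∧ (∀ a, f a ∈ Γ a) ∧
      ∀ a, (Γ a ∩ (B ∩ F q)).Nonempty → f a ∈ B ∩ F q := by
    intro q
    have hBF : IsClosed (B ∩ F q) := hB.inter Metric.isClosed_closedBall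
    have hE := h.measurableSet_inter_closed hc hBF
    -- Where the value misses the ball inside `B`, the given selection `f₀` keeps the multifunction
    -- nonempty.
    obtain ⟨f, hf, hfm⟩ := exists_measurable_selection
      (Γ := fun a => if (Γ a ∩ (B ∩ F q)).Nonempty then Γ a ∩ (B ∩ F q) else {f₀ a})
      (fun a => by split_ifs; exacts [(hc a).inter_right hBF, isCompact_singleton])
      (fun a => by split_ifs with h1; exacts [h1, Set.singleton_nonempty _])
      (fun G hG => by
        have : {a | ((if (Γ a ∩ (B ∩ F q)).Nonempty then Γ a ∩ (B ∩ F q) else {f₀ a}) ∩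
            G).Nonempty} = {a | (Γ a ∩ (B ∩ F q ∩ G)).Nonempty} ∪
            ({a | (Γ a ∩ (B ∩ F q)).Nonempty}ᶜ ∩ f₀ ⁻¹' G) := by
          ext a
          by_cases h1 : (Γ a ∩ (B ∩ F q)).Nonempty
          · simp [h1, Set.inter_assoc]
          · have h2 : ¬ (Γ a ∩ (B ∩ F q ∩ G)).Nonempty := fun ⟨x, hx, hx1, _⟩ => h1 ⟨x, hx, hx1⟩
            simp only [Set.mem_ofPred_eq, h1, h2, if_false, Set.mem_union, Set.mem_inter_iff,
              Set.mem_compl_iff, Set.mem_preimage, Set.singleton_inter_nonempty, not_false_eq_true,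
              true_and, false_or]
        rw [this]
        exact (h.measurableSet_inter_closed hc (hBF.inter hG)).union
          (hE.compl.inter (hf₀ hG.measurableSet)))
    refine ⟨f, hf, fun a => ?_, fun a ha => ?_⟩
    · have := hfm a
      split_ifs at this with h1
      · exact this.1
      · rw [Set.mem_singleton_iff.1 this]; exact hf₀Γ a
    · have := hfm a
      rw [if_pos ha] at this
      exact this.2
  choose f hf hfΓ hfF using hsel
  refine ⟨fun i => f (Nat.unpair i), fun i => hf _, fun i => hfΓ _, fun a x hx => ?_⟩
  have happ : ∀ j : ℕ, ∃ n, dist x (TopologicalSpace.denseSeq (ℕ → ℝ) n) < 1 / ((j : ℝ) + 1) :=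
    fun j => (TopologicalSpace.denseRange_denseSeq (ℕ → ℝ)).exists_dist_lt x (by positivity)
  choose n hn using happ
  have hmem : ∀ j, f (n j, j) a ∈ B ∩ F (n j, j) := fun j =>
    hfF _ a ⟨x, hx.1, hx.2, (hn j).le⟩
  refine ⟨fun j => Nat.pair (n j) j, fun j => by simpa using (hmem j).1, ?_⟩
  simp only [Nat.unpair_pair]
  rw [tendsto_iff_dist_tendsto_zero]
  have h0 : Tendsto (fun j : ℕ => 1 / ((j : ℝ) + 1) + 1 / ((j : ℝ) + 1)) atTop (𝓝 0) := by
    simpa using tendsto_one_div_add_atTop_nhds_zero_nat.add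
      (tendsto_one_div_add_atTop_nhds_zero_nat (𝕜 := ℝ))
  refine squeeze_zero (fun _ => dist_nonneg) (fun j => ?_) h0
  refine (dist_triangle _ (TopologicalSpace.denseSeq (ℕ → ℝ) (n j)) _).trans
    (add_le_add (hmem j).2 ?_)
  rw [dist_comm]
  exact (hn j).le

/-! ### Minimizing selections for the conditional expected utility -/

namespace Utility

variable {p : ℝ≥0∞} {ν : Measure ℝ} {α β : Type*} [MeasurableSpace α] [MeasurableSpace β]

theorem tendsto_integral_of_tendsto_sample (μ : Measure β) [IsFiniteMeasure μ] {ζ : β → ℝ}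
    (hζ : Measurable ζ) {u : Utility p ν} {v : ℕ → Utility p ν} {k : ℝ}
    (hk : ∀ j n, |sample (v j) n| ≤ k)
    (h : Tendsto (fun j => sample (v j)) atTop (𝓝 (sample u))) :
    Tendsto (fun j => ∫ b, v j (ζ b) ∂μ) atTop (𝓝 (∫ b, u (ζ b) ∂μ)) :=
  tendsto_integral_of_dominated_convergence (fun _ => k)
    (fun j => ((v j).continuous_toFun.measurable.comp hζ).aestronglyMeasurable)
    (integrable_const k) (fun j => ae_of_all _ fun b => abs_le_of_sample (hk j) (ζ b))
    (ae_of_all _ fun b => tendsto_of_tendsto_sample h (ζ b))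

theorem measurable_uncurry_ite {u v : α → Utility p ν}
    (hu : Measurable fun q : α × ℝ => u q.1 q.2) (hv : Measurable fun q : α × ℝ => v q.1 q.2)
    {s : Set α} [DecidablePred (· ∈ s)] (hs : MeasurableSet s) :
    Measurable fun q : α × ℝ => (if q.1 ∈ s then u q.1 else v q.1) q.2 := by
  have : (fun q : α × ℝ => (if q.1 ∈ s then u q.1 else v q.1) q.2) =
      fun q => if q.1 ∈ s then u q.1 q.2 else v q.1 q.2 := by
    ext q
    split_ifs <;> rfl
  rw [this]
  exact Measurable.ite (measurable_fst hs) hu hv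

theorem measurable_integral (κ : Kernel α β) [IsMarkovKernel κ] {ζ : β → ℝ} (hζ : Measurable ζ)
    {u : α → Utility p ν} (hu : Measurable fun q : α × ℝ => u q.1 q.2) :
    Measurable fun a => ∫ b, u a (ζ b) ∂κ a := by
  have : Measurable fun q : α × β => u q.1 (ζ q.2) :=
    hu.comp (measurable_fst.prodMk (hζ.comp measurable_snd))
  exact (this.stronglyMeasurable.integral_kernel_prod_right' (κ := κ)).measurable

theorem measurable_lintegral_enorm (κ : Kernel α β) [IsMarkovKernel κ] {ζ : β → ℝ}
    (hζ : Measurable ζ) {u : α → Utility p ν} (hu : Measurable fun q : α × ℝ => u q.1 q.2) :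
    Measurable fun a => ∫⁻ b, ‖u a (ζ b)‖ₑ ∂κ a := by
  have : Measurable fun q : α × β => ‖u q.1 (ζ q.2)‖ₑ :=
    (hu.comp (measurable_fst.prodMk (hζ.comp measurable_snd))).enorm
  exact this.lintegral_kernel_prod_right'

/-- Countably many measurable selections of a compact-valued random set of utility functions
suffice to approximate the infimum of the expected utility. -/
theorem exists_approximating_selections [ν.IsOpenPosMeasure] (hp : 0 < p)
    {K : α → Set (Utility p ν)} (hKc : ∀ a, IsCompact (K a)) (hK : IsRandomSet K)
    (κ : Kernel α β) [IsMarkovKernel κ] {ζ : β → ℝ} (hζ : Measurable ζ)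
    {u₀ : α → Utility p ν} (hu₀ : Measurable fun q : α × ℝ => u₀ q.1 q.2)
    (hu₀K : ∀ a, u₀ a ∈ K a) :
    ∃ w : ℕ → α → Utility p ν, (∀ n, Measurable fun q : α × ℝ => w n q.1 q.2) ∧
      (∀ n a, w n a ∈ K a) ∧
      ∀ a, ∀ u ∈ K a, ∀ ε > 0, ∃ n, ∫ b, w n a (ζ b) ∂κ a < ∫ b, u (ζ b) ∂κ a + ε := by
  let Γ : α → Set (ℕ → ℝ) := fun a => sample '' K a
  have hΓ : IsRandomSet Γ := fun G hG => by
    have := hK _ (hG.preimage (continuous_sample (ν := ν) hp))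
    convert this using 1
    ext a
    exact Set.image_inter_nonempty_iff
  have hΓc : ∀ a, IsCompact (Γ a) := fun a => (hKc a).image (continuous_sample hp)
  -- Pointwise convergence alone does not pass to integrals. Each u is bounded by some k, and
  -- approximating it within `B k` supplies a constant dominating function.
  let B : ℕ → Set (ℕ → ℝ) := fun k => {x | ∀ n, |x n| ≤ k}
  have hB : ∀ k, IsClosed (B k) := fun k => by
    have : B k = ⋂ n, {x : ℕ → ℝ | |x n| ≤ k} := by ext; simp [B]
    rw [this]
    exact isClosed_iInter fun n => isClosed_le (continuous_apply n).abs continuous_const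
  choose f hf hfΓ hfB using fun k => exists_dense_measurable_selections hΓ hΓc
    (measurable_sample hu₀) (fun a => ⟨u₀ a, hu₀K a, rfl⟩) (hB k)
  choose w hwK hw using hfΓ
  refine ⟨fun n => w n.unpair.1 n.unpair.2, fun n => ?_, fun n => hwK _ _, fun a u hu ε hε => ?_⟩
  · refine measurable_uncurry ?_
    simp only [hw]
    exact hf _ _
  · obtain ⟨C, hC⟩ := u.bounded_toFun
    obtain ⟨k, hk⟩ := exists_nat_ge C
    obtain ⟨i, hiB, hi⟩ := hfB k a (sample u) ⟨⟨u, hu, rfl⟩, fun n => (hC _).trans hk⟩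
    simp only [← hw] at hiB hi
    have := tendsto_integral_of_tendsto_sample (κ a) hζ (fun j n => hiB j n) hi
    obtain ⟨j, hj⟩ := (this.eventually_lt_const (lt_add_of_pos_right _ hε)).exists
    exact ⟨Nat.pair k (i j), by simpa using hj⟩

/-- Selections with controlled absolute moments whose expected utilities decrease to the infimum. -/
theorem exists_minimizing_selections [ν.IsOpenPosMeasure] (hp : 0 < p)
    {K : α → Set (Utility p ν)} (hKc : ∀ a, IsCompact (K a)) (hK : IsRandomSet K)
    (κ : Kernel α β) [IsMarkovKernel κ] {ζ : β → ℝ} (hζ : Measurable ζ)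
    {u₀ : α → Utility p ν} (hu₀ : Measurable fun q : α × ℝ => u₀ q.1 q.2)
    (hu₀K : ∀ a, u₀ a ∈ K a) :
    ∃ v : ℕ → α → Utility p ν, (∀ n, Measurable fun q : α × ℝ => v n q.1 q.2) ∧
      (∀ n a, v n a ∈ K a) ∧ v 0 = u₀ ∧
      (∀ a, Antitone fun n => ∫ b, v n a (ζ b) ∂κ a) ∧
      (∀ a, ∀ u ∈ K a, ∀ ε > 0, ∃ n, ∫ b, v n a (ζ b) ∂κ a < ∫ b, u (ζ b) ∂κ a + ε) ∧
      ∀ n, ∃ k : ℕ, ∀ a,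
        ∫⁻ b, ‖v n a (ζ b)‖ₑ ∂κ a ≤ k + ∫⁻ b, ‖u₀ a (ζ b)‖ₑ ∂κ a := by
  classical
  obtain ⟨w, hw, hwK, hwa⟩ := exists_approximating_selections hp hKc hK κ hζ hu₀ hu₀K
  -- The index n encodes a selection and a moment bound. Off `S n` the selection reverts to `u₀`, so
  -- the moment control is uniform in a.
  let S (n : ℕ) : Set α := {a | ∫⁻ b, ‖w n.unpair.1 a (ζ b)‖ₑ ∂κ a ≤ n.unpair.2}
  have hS : ∀ n, MeasurableSet (S n) := fun n =>
    measurableSet_le (measurable_lintegral_enorm κ hζ (hw _)) measurable_const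
  let w' (n : ℕ) (a : α) : Utility p ν := if a ∈ S n then w n.unpair.1 a else u₀ a
  have hw' : ∀ n, Measurable fun q : α × ℝ => w' n q.1 q.2 := fun n =>
    measurable_uncurry_ite (hw _) hu₀ (hS n)
  have hw'K : ∀ n a, w' n a ∈ K a := fun n a => by
    simp only [w']; split_ifs; exacts [hwK _ _, hu₀K _]
  have hw'b : ∀ n a, ∫⁻ b, ‖w' n a (ζ b)‖ₑ ∂κ a ≤
      n.unpair.2 + ∫⁻ b, ‖u₀ a (ζ b)‖ₑ ∂κ a := fun n a => by
    by_cases h : a ∈ S n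
    · simp only [w', if_pos h]; exact le_trans h le_self_add
    · simp only [w', if_neg h]; exact le_add_self
  let R (n : ℕ) (f : α → Utility p ν) : Set α :=
    {a | ∫ b, w' n a (ζ b) ∂κ a < ∫ b, f a (ζ b) ∂κ a}
  -- Running minimum: switch to `w' n` exactly where it strictly lowers the expectation.
  let v : ℕ → α → Utility p ν := fun n =>
    Nat.rec u₀ (fun n f a => if a ∈ R n f then w' n a else f a) n
  have hvs : ∀ n a, v (n + 1) a = if a ∈ R n (v n) then w' n a else v n a := fun n a => rfl
  have hv : ∀ n, Measurable fun q : α × ℝ => v n q.1 q.2 := by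
    intro n
    induction n with
    | zero => exact hu₀
    | succ n ih =>
      simp only [hvs]
      exact measurable_uncurry_ite (hw' n) ih
        (measurableSet_lt (measurable_integral κ hζ (hw' n)) (measurable_integral κ hζ ih))
  have hanti : ∀ a, Antitone fun n => ∫ b, v n a (ζ b) ∂κ a := fun a =>
    antitone_nat_of_succ_le fun n => by
      by_cases h : a ∈ R n (v n)
      · simp only [hvs, if_pos h]; exact le_of_lt h
      · simp only [hvs, if_neg h]; exact le_rfl
  refine ⟨v, hv, fun n a => ?_, rfl, hanti, fun a u hu ε hε => ?_, fun n => ?_⟩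
  · induction n with
    | zero => exact hu₀K a
    | succ n ih => rw [hvs]; split_ifs; exacts [hw'K n a, ih]
  · obtain ⟨m, hm⟩ := hwa a u hu ε hε
    have hfin : ∫⁻ b, ‖w m a (ζ b)‖ₑ ∂κ a < ∞ := (integrable_comp (κ a) hζ (w m a)).2
    -- At a fixed a the moment is finite, so some index pairs selection m with a bound that does not
    -- truncate it there.
    obtain ⟨k, hk⟩ := ENNReal.exists_nat_gt hfin.ne
    refine ⟨Nat.pair m k + 1, lt_of_le_of_lt ?_ hm⟩
    have hmem : a ∈ S (Nat.pair m k) := by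
      change ∫⁻ b, ‖w (Nat.unpair _).1 a (ζ b)‖ₑ ∂κ a ≤ ((Nat.unpair _).2 : ℕ)
      simpa using hk.le
    have heq : w' (Nat.pair m k) a = w m a := by simp only [w', if_pos hmem, Nat.unpair_pair]
    rw [← heq]
    by_cases h : a ∈ R (Nat.pair m k) (v (Nat.pair m k))
    · simp only [hvs, if_pos h]; exact le_rfl
    · simp only [hvs, if_neg h]; exact not_lt.1 h
  · induction n with
    | zero => exact ⟨0, fun a => by simp [v]⟩
    | succ n ih =>
      obtain ⟨k, hk⟩ := ih
      refine ⟨max k n.unpair.2, fun a => ?_⟩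
      by_cases h : a ∈ R n (v n)
      · simp only [hvs, if_pos h]
        exact (hw'b n a).trans (add_le_add (Nat.cast_le.2 (le_max_right _ _)) le_rfl)
      · simp only [hvs, if_neg h]
        exact (hk a).trans (add_le_add (Nat.cast_le.2 (le_max_left _ _)) le_rfl)

end Utility

/-! ### Histories -/

namespace Hist

variable {d : ℕ → ℕ} {t : ℕ}

theorem past_extend_self (h : Hist d t) (y : EuclideanSpace ℝ (Fin (d t))) :
    (h.extend y).past t t.le_succ = h := by
  funext i
  exact Fin.snoc_castSucc (α := fun i : Fin (t + 1) => EuclideanSpace ℝ (Fin (d i))) y h i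

theorem past_past (h : Hist d t) {s r : ℕ} (hs : s ≤ t) (hr : r ≤ s) :
    (h.past s hs).past r hr = h.past r (hr.trans hs) := rfl

theorem past_extend (h : Hist d t) (y : EuclideanSpace ℝ (Fin (d t))) {s : ℕ} (hs : s ≤ t) :
    (h.extend y).past s (hs.trans t.le_succ) = h.past s hs := by
  rw [← past_past _ t.le_succ hs, past_extend_self]

theorem measurable_extend :
    Measurable fun q : Hist d t × EuclideanSpace ℝ (Fin (d t)) => q.1.extend q.2 := by
  refine measurable_pi_lambda _ fun i => ?_
  induction i using Fin.lastCases with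
  | last =>
    have : (fun q : Hist d t × EuclideanSpace ℝ (Fin (d t)) => q.1.extend q.2 (Fin.last t)) =
        fun q => q.2 := by
      funext q
      exact Fin.snoc_last (α := fun i : Fin (t + 1) => EuclideanSpace ℝ (Fin (d i))) q.2 q.1
    rw [this]
    exact measurable_snd
  | cast i =>
    have : (fun q : Hist d t × EuclideanSpace ℝ (Fin (d t)) => q.1.extend q.2 i.castSucc) =
        fun q => q.1 i := by
      funext q
      exact Fin.snoc_castSucc (α := fun i : Fin (t + 1) => EuclideanSpace ℝ (Fin (d i))) q.2 q.1 i
    rw [this]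
    exact (measurable_pi_apply i).comp measurable_fst

end Hist

section

variable {Ω : Type*} {d : ℕ → ℕ}

theorem history_succ (ξ : ∀ i : ℕ, Ω → EuclideanSpace ℝ (Fin (d i))) (t : ℕ) (ω : Ω) :
    history ξ (t + 1) ω = (history ξ t ω).extend (ξ t ω) := by
  funext i
  induction i using Fin.lastCases with
  | last => exact (Fin.snoc_last (α := fun i : Fin (t + 1) => EuclideanSpace ℝ (Fin (d i)))
      (ξ t ω) (history ξ t ω)).symm
  | cast i => exact (Fin.snoc_castSucc (α := fun i : Fin (t + 1) => EuclideanSpace ℝ (Fin (d i)))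
      (ξ t ω) (history ξ t ω) i).symm

theorem past_history (ξ : ∀ i : ℕ, Ω → EuclideanSpace ℝ (Fin (d i))) {s t : ℕ} (hs : s ≤ t)
    (ω : Ω) : (history ξ t ω).past s hs = history ξ s ω := rfl

theorem measurable_history [MeasurableSpace Ω] {ξ : ∀ i : ℕ, Ω → EuclideanSpace ℝ (Fin (d i))}
    (hξ : ∀ i, Measurable (ξ i)) (t : ℕ) : Measurable (history ξ t) :=
  measurable_pi_lambda _ fun i => hξ i

theorem Hist.measurable_past {t s : ℕ} (hs : s ≤ t) :
    Measurable fun h : Hist d t => h.past s hs :=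
  measurable_pi_lambda _ fun i => measurable_pi_apply (Fin.castLE hs i)

end

/-! ### Stage sets of the ambiguity set -/

section

variable {p : ℝ≥0∞} {ν : Measure ℝ} {d : ℕ → ℕ} {T : ℕ}
  {U : ∀ t : ℕ, Hist d t → Set (Utility p ν)}

/-- A member of the ambiguity set can be modified at a single history. -/
theorem exists_mem_ambiguitySet_eq_at {𝔲 : UtilitySeq p ν d} (h𝔲 : 𝔲 ∈ ambiguitySet T U) {t : ℕ}
    (h : Hist d t) {u : Utility p ν} (hu : u ∈ U t h) :
    ∃ 𝔳 ∈ ambiguitySet T U, (∀ s, s ≠ t → 𝔳 s = 𝔲 s) ∧ 𝔳 t h = u := by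
  classical
  refine ⟨Function.update 𝔲 t (fun h' => if h' ∈ ({h} : Set (Hist d t)) then u else 𝔲 t h'),
    fun s hs => ?_, fun s hs => Function.update_of_ne hs _ _, by simp⟩
  by_cases hst : s = t
  · subst hst
    rw [Function.update_self]
    refine ⟨Utility.measurable_uncurry_ite (u := fun _ => u)
      (u.continuous_toFun.measurable.comp measurable_snd) (h𝔲 s hs).1
      (measurableSet_singleton h), fun h' => ?_⟩
    split_ifs with h1
    · rw [Set.mem_singleton_iff.1 h1]; exact hu
    · exact (h𝔲 s hs).2 h'
  · rw [Function.update_of_ne hst]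
    exact h𝔲 s hs

theorem stageSet_ambiguitySet {𝔲 : UtilitySeq p ν d} (h𝔲 : 𝔲 ∈ ambiguitySet T U) {t : ℕ}
    (ht : t < T) (h : Hist d t) :
    stageSet (ambiguitySet T U) t (fun s => 𝔲 s (h.past s s.isLt.le)) h = U t h := by
  ext u
  constructor
  · rintro ⟨𝔳, h𝔳, -, rfl⟩
    exact (h𝔳 t ht).2 h
  · intro hu
    obtain ⟨𝔳, h𝔳, heq, hat⟩ := exists_mem_ambiguitySet_eq_at h𝔲 h hu
    exact ⟨𝔳, h𝔳, fun s => by rw [heq s s.isLt.ne], hat⟩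

variable {Ω : Type*} [MeasurableSpace Ω] (P : Measure Ω) [IsProbabilityMeasure P]
  (ξ : ∀ i : ℕ, Ω → EuclideanSpace ℝ (Fin (d i))) (Z : ℕ → Ω → ℝ)

/-- The induction needs the earlier utilities to be the trace of some member along h. Modifying that
member at h alone realizes the next choice u and leaves the earlier trace intact, so the hypothesis
survives every extension of h. -/
theorem nestedValue_stageSet_ambiguitySet {n t : ℕ} (hnt : t + n = T) {𝔲 : UtilitySeq p ν d}
    (h𝔲 : 𝔲 ∈ ambiguitySet T U) (h : Hist d t) {pre : Fin t → Utility p ν}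
    (hpre : ∀ s : Fin t, pre s = 𝔲 s (h.past s s.isLt.le)) :
    nestedValue P ξ Z (stageSet (ambiguitySet T U)) n t pre h =
      nestedValue P ξ Z (fun t _ h => U t h) n t pre h := by
  induction n generalizing t 𝔲 with
  | zero => rfl
  | succ n ih =>
    have hS : stageSet (ambiguitySet T U) t pre h = U t h := by
      rw [funext hpre]
      exact stageSet_ambiguitySet h𝔲 (by omega) h
    simp only [nestedValue, hS]
    refine iInf_congr fun u => iInf_congr fun hu => ?_
    obtain ⟨𝔳, h𝔳, heq, hat⟩ := exists_mem_ambiguitySet_eq_at h𝔲 h hu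
    congr 1
    funext q
    congr 1
    refine ih (by omega) h𝔳 _ fun s => ?_
    induction s using Fin.lastCases with
    | last =>
      rw [Fin.snoc_last, ← hat]
      exact congrArg (𝔳 t) (Hist.past_extend_self h q.2).symm
    | cast s =>
      rw [Fin.snoc_castSucc, hpre s, ← heq s s.isLt.ne]
      exact congrArg (𝔳 s) (Hist.past_extend h q.2 s.isLt.le).symm

end

/-! ### Extended-real differences and extended expectations -/

theorem EReal.coe_ennreal_sub_eq_of_add_eq {a b c e : ℝ≥0∞} (ha : a ≠ ⊤) (hc : c ≠ ⊤)
    (h : c + b = a + e) : (c : EReal) - e = (a : EReal) - b := by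
  by_cases hb : b = ⊤
  · have he : e = ⊤ := by
      rw [hb, add_top] at h
      exact (ENNReal.add_eq_top.1 h.symm).resolve_left ha
    simp [hb, he]
  · have he : e ≠ ⊤ := fun he => by
      rw [he, add_top] at h
      exact (ENNReal.add_ne_top.2 ⟨hc, hb⟩) h
    lift a to NNReal using ha
    lift b to NNReal using hb
    lift c to NNReal using hc
    lift e to NNReal using he
    have h' : (c : ℝ) + b = a + e := by exact_mod_cast h
    have h2 : (c : ℝ) - e = (a : ℝ) - b := by linarith
    exact congrArg Real.toEReal h2

theorem EReal.toENNReal_coe_sub_add {a b : ℝ≥0∞} (ha : a ≠ ⊤) :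
    ((a : EReal) - b).toENNReal + b = a + (-((a : EReal) - b)).toENNReal := by
  by_cases hb : b = ⊤
  · simp [hb]
  · lift a to NNReal using ha
    lift b to NNReal using hb
    have h1 : ((a : ℝ≥0∞) : EReal) - ((b : ℝ≥0∞) : EReal) = (((a : ℝ) - b : ℝ) : EReal) := rfl
    rw [h1, ← EReal.coe_neg, EReal.real_coe_toENNReal, EReal.real_coe_toENNReal, _root_.neg_sub,
      ENNReal.ofReal_sub _ b.coe_nonneg, ENNReal.ofReal_sub _ a.coe_nonneg, ENNReal.ofReal_coe_nnreal,
      ENNReal.ofReal_coe_nnreal, tsub_add_eq_max, add_tsub_eq_max]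

theorem EReal.toENNReal_sub_toENNReal_neg (x : EReal) :
    (x.toENNReal : EReal) - ((-x).toENNReal : EReal) = x := by
  rcases le_total 0 x with hx | hx
  · rw [EReal.coe_toENNReal hx, EReal.toENNReal_of_nonpos (x := -x) (by simpa using hx)]
    simp
  · rw [EReal.toENNReal_of_nonpos hx, EReal.coe_toENNReal (x := -x) (by simpa using hx)]
    simp

theorem EReal.sub_add_sub_comm_of_ne_top {a b c e : ℝ≥0∞} (ha : a ≠ ⊤) (hc : c ≠ ⊤) :
    ((a : EReal) - b) + ((c : EReal) - e) = ((a + c : ℝ≥0∞) : EReal) - ((b + e : ℝ≥0∞) : EReal) := by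
  by_cases hb : b = ⊤
  · simp [hb]
  by_cases he : e = ⊤
  · simp [he]
  lift a to NNReal using ha
  lift b to NNReal using hb
  lift c to NNReal using hc
  lift e to NNReal using he
  have : ((a : ℝ) - b) + (c - e) = ((a : ℝ) + c) - (b + e) := by ring
  exact congrArg Real.toEReal this

theorem EReal.sub_coe_ennreal_le (x : EReal) (b : ℝ≥0∞) : x - b ≤ x :=
  (EReal.sub_le_sub le_rfl (EReal.coe_ennreal_nonneg b)).trans_eq (sub_zero x)

theorem EReal.sub_ne_top_of_ne_top {a b : ℝ≥0∞} (ha : a ≠ ⊤) : (a : EReal) - b ≠ ⊤ := by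
  lift a to NNReal using ha
  intro h
  have : (a : EReal) - b ≤ a := EReal.sub_coe_ennreal_le _ _
  rw [h, top_le_iff] at this
  exact EReal.coe_ne_top _ this

/-- Both restrictions matter as ⊥ + ⊤ = ⊥: for c = ⊤ the infimum of the r could be ⊥, and for c = ⊥
an empty infimum would be ⊤ on the left only. -/
theorem EReal.biInf_coe_add {ι : Type*} {K : Set ι} (hK : K.Nonempty) (r : ι → ℝ) {c : EReal}
    (hc : c ≠ ⊤) : ⨅ u ∈ K, ((r u : EReal) + c) = (⨅ u ∈ K, (r u : EReal)) + c := by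
  induction c with
  | top => exact absurd rfl hc
  | bot => simpa using biInf_const hK
  | coe c =>
    refine le_antisymm ?_ (le_iInf₂ fun u hu => add_le_add_left (iInf₂_le u hu) _)
    rw [← EReal.sub_le_iff_le_add (.inl (EReal.coe_ne_bot c)) (.inl (EReal.coe_ne_top c))]
    refine le_iInf₂ fun u hu => ?_
    rw [EReal.sub_le_iff_le_add (.inl (EReal.coe_ne_bot c)) (.inl (EReal.coe_ne_top c))]
    exact iInf₂_le u hu

section

variable {α : Type*} [MeasurableSpace α] {μ : Measure α}

/-- Here a and b need not be the positive and negative parts of f. The identity f⁺ + b = a + f⁻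
integrates without subtraction, and finiteness of the integrals of a and f⁺ lets it be rearranged
afterwards. -/
theorem extExpectation_eq_sub {f : α → EReal} {a b : α → ℝ≥0∞} (ha : Measurable a)
    (hb : Measurable b) (hfin : ∫⁻ x, a x ∂μ ≠ ⊤)
    (h : ∀ᵐ x ∂μ, f x = (a x : EReal) - b x) :
    extExpectation μ f = ((∫⁻ x, a x ∂μ : ℝ≥0∞) : EReal) - ((∫⁻ x, b x ∂μ : ℝ≥0∞) : EReal) := by
  have hle : ∫⁻ x, (f x).toENNReal ∂μ ≤ ∫⁻ x, a x ∂μ := lintegral_mono_ae <| by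
    filter_upwards [h] with x hx
    rw [hx]
    exact (EReal.toENNReal_le_toENNReal (EReal.sub_coe_ennreal_le _ _)).trans_eq
      EReal.toENNReal_coe
  have hne : ∫⁻ x, (f x).toENNReal ∂μ ≠ ⊤ := ne_top_of_le_ne_top hfin hle
  have hadd : ∫⁻ x, (f x).toENNReal ∂μ + ∫⁻ x, b x ∂μ =
      ∫⁻ x, a x ∂μ + ∫⁻ x, (-f x).toENNReal ∂μ := by
    rw [← lintegral_add_right _ hb, ← lintegral_add_left ha]
    refine lintegral_congr_ae ?_
    filter_upwards [h, ae_lt_top ha hfin] with x hx hax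
    rw [hx]
    exact EReal.toENNReal_coe_sub_add hax.ne
  rw [extExpectation, if_neg hne]
  exact EReal.coe_ennreal_sub_eq_of_add_eq hfin hne hadd

theorem EReal.coe_integral_eq_sub {g : α → ℝ} (hg : Integrable g μ) :
    ((∫ x, g x ∂μ : ℝ) : EReal) = ((∫⁻ x, ENNReal.ofReal (g x) ∂μ : ℝ≥0∞) : EReal) -
      ((∫⁻ x, ENNReal.ofReal (-g x) ∂μ : ℝ≥0∞) : EReal) := by
  have hneg : ∫⁻ x, ENNReal.ofReal (-g x) ∂μ ≠ ⊤ := hg.neg.lintegral_lt_top.ne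
  rw [integral_eq_lintegral_pos_part_sub_lintegral_neg_part hg, EReal.coe_sub,
    EReal.coe_ennreal_toReal hg.lintegral_lt_top.ne,
    EReal.coe_ennreal_toReal hneg]

theorem extExpectation_coe {g : α → ℝ} (hg : Integrable g μ) :
    extExpectation μ (fun x => (g x : EReal)) = ((∫ x, g x ∂μ : ℝ) : EReal) := by
  rw [EReal.coe_integral_eq_sub hg, extExpectation, if_neg]
  · rfl
  · exact hg.lintegral_lt_top.ne

theorem extExpectation_coe_add {g : α → ℝ} (hgm : Measurable g) (hg : Integrable g μ)
    {f : α → EReal} {a b : α → ℝ≥0∞} (ha : Measurable a) (hb : Measurable b)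
    (hfin : ∫⁻ x, a x ∂μ ≠ ⊤) (h : ∀ᵐ x ∂μ, f x = (a x : EReal) - b x) :
    extExpectation μ (fun x => (g x : EReal) + f x) = ((∫ x, g x ∂μ : ℝ) : EReal) +
      (((∫⁻ x, a x ∂μ : ℝ≥0∞) : EReal) - ((∫⁻ x, b x ∂μ : ℝ≥0∞) : EReal)) := by
  rw [EReal.coe_integral_eq_sub hg, EReal.sub_add_sub_comm_of_ne_top hg.lintegral_lt_top.ne hfin,
    ← lintegral_add_right _ ha, ← lintegral_add_right _ hb]
  refine extExpectation_eq_sub (hgm.ennreal_ofReal.add ha) (hgm.neg.ennreal_ofReal.add hb) ?_ ?_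
  · rw [lintegral_add_right _ ha]
    exact ENNReal.add_ne_top.2 ⟨hg.lintegral_lt_top.ne, hfin⟩
  · filter_upwards [h, ae_lt_top ha hfin] with x hx hax
    rw [hx, ← EReal.sub_add_sub_comm_of_ne_top ENNReal.ofReal_ne_top hax.ne]
    congr 1
    rw [← EReal.real_coe_toENNReal, ← EReal.real_coe_toENNReal, EReal.coe_neg,
      EReal.toENNReal_sub_toENNReal_neg]

end

/-! ### Interchange of infimum and integral at one stage -/

namespace Utility

variable {p : ℝ≥0∞} {ν : Measure ℝ} {α β : Type*} [MeasurableSpace α] [MeasurableSpace β]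

/-- The worst-case conditional expected utility over the sets `K a`. -/
noncomputable def stageInf (κ : Kernel α β) (ζ : β → ℝ) (K : α → Set (Utility p ν)) (a : α) :
    EReal :=
  ⨅ u ∈ K a, ((∫ b, u (ζ b) ∂κ a : ℝ) : EReal)

variable {κ : Kernel α β} {ζ : β → ℝ} {K : α → Set (Utility p ν)}

theorem stageInf_le {a : α} {u : Utility p ν} (hu : u ∈ K a) :
    stageInf κ ζ K a ≤ ((∫ b, u (ζ b) ∂κ a : ℝ) : EReal) :=
  iInf₂_le u hu

theorem toENNReal_stageInf_le {a : α} {u : Utility p ν} (hu : u ∈ K a) :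
    (stageInf κ ζ K a).toENNReal ≤ ∫⁻ b, ‖u (ζ b)‖ₑ ∂κ a :=
  (EReal.toENNReal_le_toENNReal (stageInf_le hu)).trans <| by
    rw [EReal.real_coe_toENNReal]
    refine le_trans ?_ (enorm_integral_le_lintegral_enorm _)
    rw [← ofReal_norm]
    exact ENNReal.ofReal_le_ofReal (le_abs_self _)

theorem toENNReal_stageInf_ne_top [IsMarkovKernel κ] (hζ : Measurable ζ) {a : α}
    (hK : (K a).Nonempty) : (stageInf κ ζ K a).toENNReal ≠ ⊤ :=
  ne_top_of_le_ne_top (integrable_comp (κ a) hζ hK.some).2.ne (toENNReal_stageInf_le hK.some_mem)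

/-- Reduces an uncountable infimum to a countable one, from which measurability follows. -/
theorem stageInf_eq_iInf {v : ℕ → α → Utility p ν} (hvK : ∀ n a, v n a ∈ K a)
    (hv : ∀ a, ∀ u ∈ K a, ∀ ε > 0, ∃ n, ∫ b, v n a (ζ b) ∂κ a < ∫ b, u (ζ b) ∂κ a + ε) (a : α) :
    stageInf κ ζ K a = ⨅ n, ((∫ b, v n a (ζ b) ∂κ a : ℝ) : EReal) := by
  refine le_antisymm (le_iInf fun n => stageInf_le (hvK n a)) (le_iInf₂ fun u hu => ?_)
  refine EReal.le_of_forall_lt_iff_le.1 fun z hz => ?_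
  have hz' := EReal.coe_lt_coe_iff.1 hz
  obtain ⟨n, hn⟩ := hv a u hu (z - ∫ b, u (ζ b) ∂κ a) (by linarith)
  exact (iInf_le _ n).trans (EReal.coe_le_coe_iff.2 (by linarith))

theorem measurable_stageInf [ν.IsOpenPosMeasure] (hp : 0 < p) (hKc : ∀ a, IsCompact (K a))
    (hK : IsRandomSet K) [IsMarkovKernel κ] (hζ : Measurable ζ) {u₀ : α → Utility p ν}
    (hu₀ : Measurable fun q : α × ℝ => u₀ q.1 q.2) (hu₀K : ∀ a, u₀ a ∈ K a) :
    Measurable (stageInf κ ζ K) := by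
  obtain ⟨v, hv, hvK, -, -, hva, -⟩ := exists_minimizing_selections hp hKc hK κ hζ hu₀ hu₀K
  rw [funext (stageInf_eq_iInf hvK hva)]
  exact Measurable.iInf fun n => (measurable_integral κ hζ (hv n)).coe_real_ereal

/-- Interchange of infimum and integral for one stage: measurable integrable selections reach
each level above the integral of the pointwise infimum. -/
theorem exists_selection_integral_lt [ν.IsOpenPosMeasure] (hp : 0 < p)
    (hKc : ∀ a, IsCompact (K a)) (hK : IsRandomSet K) [IsMarkovKernel κ] (hζ : Measurable ζ)
    {μ : Measure α} [IsProbabilityMeasure μ] {u₀ : α → Utility p ν}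
    (hu₀ : Measurable fun q : α × ℝ => u₀ q.1 q.2) (hu₀K : ∀ a, u₀ a ∈ K a)
    (hint : Integrable (fun q : α × β => u₀ q.1 (ζ q.2)) (μ ⊗ₘ κ)) {r : ℝ}
    (hr : ((∫⁻ a, (stageInf κ ζ K a).toENNReal ∂μ : ℝ≥0∞) : EReal) -
      ((∫⁻ a, (-stageInf κ ζ K a).toENNReal ∂μ : ℝ≥0∞) : EReal) < r) :
    ∃ v : α → Utility p ν, (Measurable fun q : α × ℝ => v q.1 q.2) ∧ (∀ a, v a ∈ K a) ∧
      Integrable (fun q : α × β => v q.1 (ζ q.2)) (μ ⊗ₘ κ) ∧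
      ∫ q, v q.1 (ζ q.2) ∂(μ ⊗ₘ κ) < r := by
  obtain ⟨v, hv, hvK, hv0, hanti, hva, hvb⟩ :=
    exists_minimizing_selections hp hKc hK κ hζ hu₀ hu₀K
  have hmeas : ∀ n, Measurable fun q : α × β => v n q.1 (ζ q.2) := fun n =>
    (hv n).comp (measurable_fst.prodMk (hζ.comp measurable_snd))
  have hu₀fin : ∫⁻ a, ∫⁻ b, ‖u₀ a (ζ b)‖ₑ ∂κ a ∂μ ≠ ⊤ := by
    have h1 := hint.2
    rw [HasFiniteIntegral, Measure.lintegral_compProd (hv0 ▸ hmeas 0).enorm] at h1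
    exact h1.ne
  have hvint : ∀ n, Integrable (fun q : α × β => v n q.1 (ζ q.2)) (μ ⊗ₘ κ) := fun n => by
    refine ⟨(hmeas n).aestronglyMeasurable, ?_⟩
    rw [HasFiniteIntegral, Measure.lintegral_compProd (hmeas n).enorm]
    obtain ⟨k, hk⟩ := hvb n
    refine (lintegral_mono hk).trans_lt ?_
    rw [lintegral_add_left measurable_const]
    simpa using hu₀fin.lt_top
  let I : ℕ → α → ℝ := fun n a => ∫ b, v n a (ζ b) ∂κ a
  have hI : ∀ n, Measurable (I n) := fun n => measurable_integral κ hζ (hv n)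
  have hIint : ∀ n, Integrable (I n) μ := fun n => by
    simpa [Measure.compProd] using (hvint n).integral_compProd
  have hlim : ∀ a, Tendsto (fun n => (I n a : EReal)) atTop (𝓝 (stageInf κ ζ K a)) := fun a => by
    rw [stageInf_eq_iInf hvK hva a]
    exact tendsto_atTop_iInf fun m n hmn => EReal.coe_le_coe_iff.2 (hanti a hmn)
  -- The positive parts are dominated by that of the integrable start `v 0 = u₀`; the negative parts
  -- increase, so monotone convergence covers a limit -∞ as well.
  have hpos : Tendsto (fun n => ∫⁻ a, ENNReal.ofReal (I n a) ∂μ) atTop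
      (𝓝 (∫⁻ a, (stageInf κ ζ K a).toENNReal ∂μ)) :=
    tendsto_lintegral_of_dominated_convergence (fun a => ENNReal.ofReal (I 0 a))
      (fun n => (hI n).ennreal_ofReal)
      (fun n => ae_of_all _ fun a => ENNReal.ofReal_le_ofReal (hanti a (Nat.zero_le n)))
      (hIint 0).lintegral_lt_top.ne
      (ae_of_all _ fun a => (EReal.continuous_toENNReal.tendsto _).comp (hlim a))
  have hneg : Tendsto (fun n => ∫⁻ a, ENNReal.ofReal (-I n a) ∂μ) atTop
      (𝓝 (∫⁻ a, (-stageInf κ ζ K a).toENNReal ∂μ)) :=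
    lintegral_tendsto_of_tendsto_of_monotone (fun n => (hI n).neg.ennreal_ofReal.aemeasurable)
      (ae_of_all _ fun a m n hmn => ENNReal.ofReal_le_ofReal (neg_le_neg (hanti a hmn)))
      (ae_of_all _ fun a => (EReal.continuous_toENNReal.tendsto _).comp
        ((continuous_neg.tendsto _).comp (hlim a)))
  have hfin : ∫⁻ a, (stageInf κ ζ K a).toENNReal ∂μ ≠ ⊤ :=
    ne_top_of_le_ne_top hu₀fin (lintegral_mono fun a => toENNReal_stageInf_le (hu₀K a))
  have hsub : Tendsto (fun n => ((∫ a, I n a ∂μ : ℝ) : EReal)) atTop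
      (𝓝 (((∫⁻ a, (stageInf κ ζ K a).toENNReal ∂μ : ℝ≥0∞) : EReal) -
        ((∫⁻ a, (-stageInf κ ζ K a).toENNReal ∂μ : ℝ≥0∞) : EReal))) := by
    simp only [fun n => EReal.coe_integral_eq_sub (hIint n), sub_eq_add_neg]
    refine (EReal.continuousAt_add (Or.inl ?_) (Or.inl ?_)).tendsto.comp
      (((continuous_coe_ennreal_ereal.tendsto _).comp hpos).prodMk_nhds
        ((continuous_neg.tendsto _).comp ((continuous_coe_ennreal_ereal.tendsto _).comp hneg)))
    · simpa using hfin
    · simp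
  obtain ⟨n, hn⟩ := (hsub.eventually_lt_const hr).exists
  refine ⟨v n, hv n, hvK n, hvint n, ?_⟩
  rw [Measure.integral_compProd (hvint n)]
  exact EReal.coe_lt_coe_iff.1 hn

end Utility

/-! ### The nested value as a sum of stagewise infima -/

section

variable {p : ℝ≥0∞} {ν : Measure ℝ} {d : ℕ → ℕ} {Ω : Type*} [MeasurableSpace Ω] (P : Measure Ω)
  [IsProbabilityMeasure P] (ξ : ∀ i : ℕ, Ω → EuclideanSpace ℝ (Fin (d i))) (Z : ℕ → Ω → ℝ)

/-- The regular conditional distribution of reward and observation at stage `t`, given the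
history. -/
noncomputable abbrev stageKernel (t : ℕ) :
    Kernel (Hist d t) (ℝ × EuclideanSpace ℝ (Fin (d t))) :=
  condDistrib (fun ω => (Z t ω, ξ t ω)) (history ξ t) P

/-- The expected accumulated cost over the `n` stages from `t` on, given the history. -/
noncomputable def accumulated (c : ∀ t : ℕ, Hist d t → ℝ≥0∞) : ℕ → ∀ t : ℕ, Hist d t → ℝ≥0∞
  | 0, _, _ => 0
  | n + 1, t, h =>
      c t h + ∫⁻ q, accumulated c n (t + 1) (h.extend q.2) ∂stageKernel P ξ Z t h

variable {P ξ Z}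

theorem map_history_compProd (hξ : ∀ i, Measurable (ξ i)) {t : ℕ} (hZ : Measurable (Z t)) :
    P.map (history ξ t) ⊗ₘ stageKernel P ξ Z t =
      P.map fun ω => (history ξ t ω, (Z t ω, ξ t ω)) :=
  compProd_map_condDistrib (hZ.prodMk (hξ t)).aemeasurable

theorem measurable_extend_snd {t : ℕ} :
    Measurable fun q : Hist d t × (ℝ × EuclideanSpace ℝ (Fin (d t))) => q.1.extend q.2.2 :=
  Hist.measurable_extend.comp (measurable_fst.prodMk measurable_snd.snd)

theorem map_history_succ (hξ : ∀ i, Measurable (ξ i)) {t : ℕ} (hZ : Measurable (Z t)) :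
    P.map (history ξ (t + 1)) =
      (P.map (history ξ t) ⊗ₘ stageKernel P ξ Z t).map fun q => q.1.extend q.2.2 := by
  rw [map_history_compProd hξ hZ, Measure.map_map measurable_extend_snd
    ((measurable_history hξ t).prodMk (hZ.prodMk (hξ t)))]
  congr 1
  funext ω
  exact history_succ ξ t ω

theorem lintegral_history_succ (hξ : ∀ i, Measurable (ξ i)) {t : ℕ} (hZ : Measurable (Z t))
    {f : Hist d (t + 1) → ℝ≥0∞} (hf : Measurable f) :
    ∫⁻ h, f h ∂P.map (history ξ (t + 1)) =
      ∫⁻ h, ∫⁻ q, f (h.extend q.2) ∂stageKernel P ξ Z t h ∂P.map (history ξ t) := by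
  rw [map_history_succ hξ hZ, lintegral_map hf measurable_extend_snd]
  exact Measure.lintegral_compProd (hf.comp measurable_extend_snd)

theorem measurable_accumulated {c : ∀ t : ℕ, Hist d t → ℝ≥0∞} {n t : ℕ}
    (hc : ∀ s, t ≤ s → s < t + n → Measurable (c s)) :
    Measurable (accumulated P ξ Z c n t) := by
  induction n generalizing t with
  | zero => exact measurable_const
  | succ n ih =>
    have h1 := ih (t := t + 1) fun s hs hs' => hc s (by omega) (by omega)
    exact (hc t le_rfl (by omega)).add
      (h1.comp measurable_extend_snd).lintegral_kernel_prod_right'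

/-- Tower property: the kernel followed by extension carries the law of the t-history to that of the
(t + 1)-history. -/
theorem lintegral_accumulated (hξ : ∀ i, Measurable (ξ i)) {c : ∀ t : ℕ, Hist d t → ℝ≥0∞}
    {n t : ℕ} (hZ : ∀ s < t + n, Measurable (Z s))
    (hc : ∀ s, t ≤ s → s < t + n → Measurable (c s)) :
    ∫⁻ h, accumulated P ξ Z c n t h ∂P.map (history ξ t) =
      ∑ s ∈ Finset.Ico t (t + n), ∫⁻ h, c s h ∂P.map (history ξ s) := by
  induction n generalizing t with
  | zero => simp [accumulated]
  | succ n ih =>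
    have hc' : ∀ s, t + 1 ≤ s → s < t + 1 + n → Measurable (c s) :=
      fun s hs hs' => hc s (by omega) (by omega)
    have hm : Measurable (accumulated P ξ Z c n (t + 1)) := measurable_accumulated hc'
    simp only [accumulated]
    rw [lintegral_add_left (hc t le_rfl (by omega)), Finset.sum_eq_sum_Ico_succ_bot (by omega),
      ← add_assoc, add_right_comm t n 1, ← ih (fun s hs => hZ s (by omega)) hc',
      lintegral_history_succ hξ (hZ t (by omega)) hm]

/-- Almost everywhere, the nested value is the expected accumulated difference of the positive and
negative parts of the stagewise infima. -/
theorem nestedValue_eq_accumulated {T : ℕ} {U : ∀ t : ℕ, Hist d t → Set (Utility p ν)}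
    (hξ : ∀ i, Measurable (ξ i)) (hZ : ∀ t < T, Measurable (Z t))
    (hne : ∀ t < T, ∀ h, (U t h).Nonempty)
    (hm : ∀ t < T, Measurable (Utility.stageInf (stageKernel P ξ Z t) Prod.fst (U t)))
    (hfin : ∀ t < T, ∫⁻ h, (Utility.stageInf (stageKernel P ξ Z t) Prod.fst (U t) h).toENNReal
      ∂P.map (history ξ t) ≠ ⊤) {n t : ℕ} (hnt : t + n = T) :
    ∀ᵐ h ∂P.map (history ξ t), ∀ pre, nestedValue P ξ Z (fun t _ h => U t h) n t pre h =
      (accumulated P ξ Z (fun t h =>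
        (Utility.stageInf (stageKernel P ξ Z t) Prod.fst (U t) h).toENNReal) n t h : EReal) -
      (accumulated P ξ Z (fun t h =>
        (-Utility.stageInf (stageKernel P ξ Z t) Prod.fst (U t) h).toENNReal) n t h : EReal) := by
  induction n generalizing t with
  | zero => exact ae_of_all _ fun h pre => by simp [nestedValue, accumulated]
  | succ n ih =>
    set a : ∀ t : ℕ, Hist d t → ℝ≥0∞ := fun t h =>
      (Utility.stageInf (stageKernel P ξ Z t) Prod.fst (U t) h).toENNReal
    set b : ∀ t : ℕ, Hist d t → ℝ≥0∞ := fun t h =>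
      (-Utility.stageInf (stageKernel P ξ Z t) Prod.fst (U t) h).toENNReal
    have ham : ∀ s < T, Measurable (a s) := fun s hs => (hm s hs).ereal_toENNReal
    have hbm : ∀ s < T, Measurable (b s) := fun s hs =>
      (hm s hs).neg.ereal_toENNReal
    have hA : Measurable (accumulated P ξ Z a n (t + 1)) :=
      measurable_accumulated fun s _ hs => ham s (by omega)
    have hB : Measurable (accumulated P ξ Z b n (t + 1)) :=
      measurable_accumulated fun s _ hs => hbm s (by omega)
    have hZt : Measurable (Z t) := hZ t (by omega)
    have hAfin : ∫⁻ h, ∫⁻ q, accumulated P ξ Z a n (t + 1) (h.extend q.2) ∂stageKernel P ξ Z t h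
        ∂P.map (history ξ t) ≠ ⊤ := by
      have h1 := lintegral_accumulated (P := P) (Z := Z) hξ (c := a) (n := n) (t := t + 1)
        (fun s hs => hZ s (by omega)) (fun s _ hs => ham s (by omega))
      rw [lintegral_history_succ hξ hZt hA] at h1
      rw [h1]
      refine (ENNReal.sum_lt_top.2 fun s hs => ?_).ne
      rw [Finset.mem_Ico] at hs
      exact (hfin s (by omega)).lt_top
    have hAm : Measurable fun h : Hist d t =>
        ∫⁻ q, accumulated P ξ Z a n (t + 1) (h.extend q.2) ∂stageKernel P ξ Z t h :=
      (hA.comp measurable_extend_snd).lintegral_kernel_prod_right'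
    have ih' := ih (t := t + 1) (by omega)
    rw [map_history_succ hξ hZt] at ih'
    -- The exceptional null set must not depend on `pre`: the infimum runs over possibly uncountably
    -- many u, each entering the continuation through `pre`.
    filter_upwards [Measure.ae_ae_of_ae_compProd (ae_of_ae_map measurable_extend_snd.aemeasurable
      ih'), ae_lt_top hAm hAfin] with h h1 h2 pre
    have hstep : ∀ u : Utility p ν, extExpectation (stageKernel P ξ Z t h)
        (fun q : ℝ × EuclideanSpace ℝ (Fin (d t)) => ((u q.1 : ℝ) : EReal) +
          nestedValue P ξ Z (fun t _ h => U t h) n (t + 1)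
            (Fin.snoc (α := fun _ => Utility p ν) pre u) (h.extend q.2)) =
        ((∫ q, u q.1 ∂stageKernel P ξ Z t h : ℝ) : EReal) +
          (((∫⁻ q, accumulated P ξ Z a n (t + 1) (h.extend q.2) ∂stageKernel P ξ Z t h : ℝ≥0∞) :
            EReal) -
          ((∫⁻ q, accumulated P ξ Z b n (t + 1) (h.extend q.2) ∂stageKernel P ξ Z t h : ℝ≥0∞) :
            EReal)) := fun u =>
      extExpectation_coe_add (u.continuous_toFun.measurable.comp measurable_fst)
        (u.integrable_comp _ measurable_fst)
        (hA.comp (measurable_extend_snd.comp (measurable_const.prodMk measurable_id)))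
        (hB.comp (measurable_extend_snd.comp (measurable_const.prodMk measurable_id))) h2.ne
        (h1.mono fun q hq => hq _)
    simp only [nestedValue, accumulated]
    -- The continuation term is free of u and below ⊤, so it leaves the infimum, and what remains is
    -- the stagewise infimum.
    rw [iInf_congr fun u => iInf_congr fun _ => hstep u,
      EReal.biInf_coe_add (hne t (by omega) h) _ (EReal.sub_ne_top_of_ne_top h2.ne),
      ← EReal.sub_add_sub_comm_of_ne_top
        (Utility.toENNReal_stageInf_ne_top measurable_fst (hne t (by omega) h)) h2.ne,
      EReal.toENNReal_sub_toENNReal_neg]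
    rfl

theorem EReal.sum_sub_of_ne_top {ι : Type*} (s : Finset ι) {a b : ι → ℝ≥0∞}
    (ha : ∀ i ∈ s, a i ≠ ⊤) : ∑ i ∈ s, ((a i : EReal) - b i) =
      ((∑ i ∈ s, a i : ℝ≥0∞) : EReal) - ((∑ i ∈ s, b i : ℝ≥0∞) : EReal) := by
  classical
  induction s using Finset.induction_on with
  | empty => simp
  | insert i s hi ih =>
    rw [Finset.sum_insert hi, Finset.sum_insert hi, Finset.sum_insert hi,
      ih fun j hj => ha j (Finset.mem_insert_of_mem hj),
      EReal.sub_add_sub_comm_of_ne_top (ha i (Finset.mem_insert_self i s))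
        (ENNReal.sum_lt_top.2 fun j hj => (ha j (Finset.mem_insert_of_mem hj)).lt_top).ne]

theorem nestedValue_zero_eq_sum {T : ℕ} {U : ∀ t : ℕ, Hist d t → Set (Utility p ν)}
    (hξ : ∀ i, Measurable (ξ i)) (hZ : ∀ t < T, Measurable (Z t))
    (hne : ∀ t < T, ∀ h, (U t h).Nonempty)
    (hm : ∀ t < T, Measurable (Utility.stageInf (stageKernel P ξ Z t) Prod.fst (U t)))
    (hfin : ∀ t < T, ∫⁻ h, (Utility.stageInf (stageKernel P ξ Z t) Prod.fst (U t) h).toENNReal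
      ∂P.map (history ξ t) ≠ ⊤) (pre : Fin 0 → Utility p ν) (h₀ : Hist d 0) :
    nestedValue P ξ Z (fun t _ h => U t h) T 0 pre h₀ = ∑ t ∈ Finset.range T,
      (((∫⁻ h, (Utility.stageInf (stageKernel P ξ Z t) Prod.fst (U t) h).toENNReal
        ∂P.map (history ξ t) : ℝ≥0∞) : EReal) -
      ((∫⁻ h, (-Utility.stageInf (stageKernel P ξ Z t) Prod.fst (U t) h).toENNReal
        ∂P.map (history ξ t) : ℝ≥0∞) : EReal)) := by
  have hprob : IsProbabilityMeasure (P.map (history ξ 0)) :=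
    Measure.isProbabilityMeasure_map (measurable_history hξ 0).aemeasurable
  have hconst : ∀ f : Hist d 0 → ℝ≥0∞, ∫⁻ h, f h ∂P.map (history ξ 0) = f h₀ := fun f => by
    rw [lintegral_congr fun h => congrArg f (Subsingleton.elim h h₀)]
    simp
  rw [EReal.sum_sub_of_ne_top _ fun t ht => hfin t (Finset.mem_range.1 ht)]
  have h1 := lintegral_accumulated (P := P) (Z := Z) hξ (n := T) (t := 0) (c := fun t h =>
    (Utility.stageInf (stageKernel P ξ Z t) Prod.fst (U t) h).toENNReal)
    (fun s hs => hZ s (by omega)) fun s _ hs => (hm s (by omega)).ereal_toENNReal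
  have h2 := lintegral_accumulated (P := P) (Z := Z) hξ (n := T) (t := 0) (c := fun t h =>
    (-Utility.stageInf (stageKernel P ξ Z t) Prod.fst (U t) h).toENNReal)
    (fun s hs => hZ s (by omega)) fun s _ hs => (hm s (by omega)).neg.ereal_toENNReal
  rw [hconst, zero_add, Nat.Ico_zero_eq_range] at h1 h2
  rw [← h1, ← h2]
  -- There is only one empty history, so an almost sure statement about it holds outright.
  obtain ⟨h, hh⟩ := (nestedValue_eq_accumulated hξ hZ hne hm hfin (zero_add T)).exists
  rw [Subsingleton.elim h₀ h]
  exact hh pre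

end

/-! ### Increments of nonnegative conditional mean -/

section

variable {α β : Type*} [MeasurableSpace α] [MeasurableSpace β]

/-- The second inequality is c ≤ ∫ f with negative parts moved across. In this subtraction-free form
it can be integrated over a further variable even where the integrals become infinite. -/
theorem lintegral_ofReal_le_of_le_integral {μ : Measure β} {f : β → ℝ} (hf : Integrable f μ)
    {c : ℝ} (hc : c ≤ ∫ b, f b ∂μ) :
    ENNReal.ofReal c ≤ ∫⁻ b, ENNReal.ofReal (f b) ∂μ ∧
      ENNReal.ofReal c + ∫⁻ b, ENNReal.ofReal (-f b) ∂μ ≤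
        ENNReal.ofReal (-c) + ∫⁻ b, ENNReal.ofReal (f b) ∂μ := by
  have hP : ∫⁻ b, ENNReal.ofReal (f b) ∂μ ≠ ⊤ := hf.lintegral_lt_top.ne
  have hN : ∫⁻ b, ENNReal.ofReal (-f b) ∂μ ≠ ⊤ := hf.neg.lintegral_lt_top.ne
  rw [integral_eq_lintegral_pos_part_sub_lintegral_neg_part hf] at hc
  lift ∫⁻ b, ENNReal.ofReal (f b) ∂μ to NNReal using hP with A
  lift ∫⁻ b, ENNReal.ofReal (-f b) ∂μ to NNReal using hN with B
  simp only [ENNReal.coe_toReal] at hc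
  have hB := B.coe_nonneg
  have hA := A.coe_nonneg
  constructor
  · rw [← ENNReal.ofReal_coe_nnreal]
    exact ENNReal.ofReal_le_ofReal (by linarith)
  · simp only [ENNReal.ofReal]
    norm_cast
    rw [← NNReal.coe_le_coe]
    push_cast
    rw [Real.coe_toNNReal', Real.coe_toNNReal']
    rcases le_total 0 c with h | h
    · rw [max_eq_left h, max_eq_right (by linarith)]; linarith
    · rw [max_eq_right h, max_eq_left (by linarith)]; linarith

/-- Adding an increment of nonnegative conditional mean increases the integral, in the extended
sense. -/
theorem lintegral_ofReal_compProd_step {μ : Measure α} [SFinite μ] {κ : Kernel α β}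
    [IsMarkovKernel κ] {c : α → ℝ} (hc : Measurable c) {w : α × β → ℝ} (hw : Measurable w)
    (h : ∀ᵐ a ∂μ, Integrable (fun b => w (a, b)) (κ a) ∧ 0 ≤ ∫ b, w (a, b) ∂κ a) :
    ∫⁻ a, ENNReal.ofReal (c a) ∂μ ≤ ∫⁻ q, ENNReal.ofReal (c q.1 + w q) ∂(μ ⊗ₘ κ) ∧
      ∫⁻ a, ENNReal.ofReal (c a) ∂μ + ∫⁻ q, ENNReal.ofReal (-(c q.1 + w q)) ∂(μ ⊗ₘ κ) ≤
        ∫⁻ a, ENNReal.ofReal (-c a) ∂μ + ∫⁻ q, ENNReal.ofReal (c q.1 + w q) ∂(μ ⊗ₘ κ) := by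
  have hcw : Measurable fun q : α × β => c q.1 + w q := (hc.comp measurable_fst).add hw
  have hcwn : Measurable fun q : α × β => -(c q.1 + w q) := hcw.neg
  have hcn : Measurable fun a => -c a := hc.neg
  rw [Measure.lintegral_compProd hcw.ennreal_ofReal,
    Measure.lintegral_compProd hcwn.ennreal_ofReal,
    ← lintegral_add_left hc.ennreal_ofReal, ← lintegral_add_left hcn.ennreal_ofReal]
  have key : ∀ᵐ a ∂μ, _ := h.mono fun a ha => lintegral_ofReal_le_of_le_integral
    (f := fun b => c a + w (a, b)) (c := c a) (μ := κ a) ((integrable_const _).add ha.1) (by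
      rw [integral_add (integrable_const _) ha.1]
      simpa using ha.2)
  exact ⟨lintegral_mono_ae (key.mono fun a ha => ha.1),
    lintegral_mono_ae (key.mono fun a ha => ha.2)⟩

theorem integrable_of_lintegral_ofReal {μ : Measure α} {f : α → ℝ} (hf : Measurable f)
    (h1 : ∫⁻ a, ENNReal.ofReal (f a) ∂μ ≠ ⊤) (h2 : ∫⁻ a, ENNReal.ofReal (-f a) ∂μ ≠ ⊤) :
    Integrable f μ := by
  refine ⟨hf.aestronglyMeasurable, ?_⟩
  have : ∀ a, ‖f a‖ₑ ≤ ENNReal.ofReal (f a) + ENNReal.ofReal (-f a) := fun a => by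
    rw [← ofReal_norm, Real.norm_eq_abs]
    rcases abs_choice (f a) with h | h <;> rw [h]
    exacts [le_self_add, le_add_self]
  refine (lintegral_mono this).trans_lt ?_
  rw [lintegral_add_left hf.ennreal_ofReal]
  exact ENNReal.add_lt_top.2 ⟨h1.lt_top, h2.lt_top⟩

end

/-- Replaces an ε-argument, which fails when some `x i` is ⊥: real levels above the terms are
handled one at a time, each real level being subtractable. -/
theorem EReal.le_sum_of_forall_coe_gt {n : ℕ} {x : ℕ → EReal} (hx : ∀ i < n, x i ≠ ⊤) {W : EReal}
    (h : ∀ r : ℕ → ℝ, (∀ i < n, x i < r i) → W ≤ ((∑ i ∈ Finset.range n, r i : ℝ) : EReal)) :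
    W ≤ ∑ i ∈ Finset.range n, x i := by
  induction n generalizing W with
  | zero => simpa using h 0 (by simp)
  | succ n ih =>
    have key : ∀ r : ℝ, x n < r → W ≤ ∑ i ∈ Finset.range n, x i + r := fun r hr => by
      rw [← EReal.sub_le_iff_le_add (.inl (EReal.coe_ne_bot r)) (.inl (EReal.coe_ne_top r))]
      refine ih (fun i hi => hx i (by omega)) fun s hs => ?_
      rw [EReal.sub_le_iff_le_add (.inl (EReal.coe_ne_bot r)) (.inl (EReal.coe_ne_top r))]
      have := h (Function.update s n r) fun i hi => by
        by_cases hin : i = n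
        · subst hin; simpa using hr
        · rw [Function.update_of_ne hin]; exact hs i (by omega)
      rw [Finset.sum_range_succ, Function.update_self, Finset.sum_congr rfl fun i hi =>
        Function.update_of_ne (Finset.mem_range.1 hi).ne r s, EReal.coe_add] at this
      exact this
    have hS : ∑ i ∈ Finset.range n, x i ≠ ⊤ := by
      have : ∀ m ≤ n, ∑ i ∈ Finset.range m, x i < ⊤ := fun m hm => by
        induction m with
        | zero => simp
        | succ m ihm =>
          rw [Finset.sum_range_succ]
          exact EReal.add_lt_top (ihm (by omega)).ne (hx m (by omega))
      exact (this n le_rfl).ne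
    rw [Finset.sum_range_succ]
    refine EReal.le_add_of_forall_gt (Or.inr (hx n (by omega))) (Or.inl hS) fun a ha b hb => ?_
    obtain ⟨r, hr1, hr2⟩ := EReal.lt_iff_exists_real_btwn.1 hb
    exact (key r hr1).trans (add_le_add ha.le hr2.le)

/-! ### The upper bound, and the submartingale argument -/

section

variable {p : ℝ≥0∞} {ν : Measure ℝ} {d : ℕ → ℕ} {Ω : Type*} [MeasurableSpace Ω] {P : Measure Ω}
  [IsProbabilityMeasure P] {ξ : ∀ i : ℕ, Ω → EuclideanSpace ℝ (Fin (d i))} {Z : ℕ → Ω → ℝ}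
  {T : ℕ} {U : ∀ t : ℕ, Hist d t → Set (Utility p ν)}

theorem measurable_utility_comp {t : ℕ} {v : Hist d t → Utility p ν}
    (hv : Measurable fun q : Hist d t × ℝ => v q.1 q.2) :
    Measurable fun q : Hist d t × (ℝ × EuclideanSpace ℝ (Fin (d t))) => v q.1 q.2.1 :=
  hv.comp (measurable_fst.prodMk measurable_snd.fst)

theorem integrable_stage_iff (hξ : ∀ i, Measurable (ξ i)) {t : ℕ} (hZ : Measurable (Z t))
    {v : Hist d t → Utility p ν} (hv : Measurable fun q : Hist d t × ℝ => v q.1 q.2) :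
    Integrable (fun q : Hist d t × (ℝ × EuclideanSpace ℝ (Fin (d t))) => v q.1 q.2.1)
      (P.map (history ξ t) ⊗ₘ stageKernel P ξ Z t) ↔
      Integrable (fun ω => v (history ξ t ω) (Z t ω)) P := by
  rw [map_history_compProd hξ hZ]
  exact integrable_map_measure (measurable_utility_comp hv).aestronglyMeasurable
    ((measurable_history hξ t).prodMk (hZ.prodMk (hξ t))).aemeasurable

theorem integral_stage (hξ : ∀ i, Measurable (ξ i)) {t : ℕ} (hZ : Measurable (Z t))
    {v : Hist d t → Utility p ν} (hv : Measurable fun q : Hist d t × ℝ => v q.1 q.2) :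
    ∫ q, v q.1 q.2.1 ∂(P.map (history ξ t) ⊗ₘ stageKernel P ξ Z t) =
      ∫ ω, v (history ξ t ω) (Z t ω) ∂P := by
  rw [map_history_compProd hξ hZ]
  exact integral_map ((measurable_history hξ t).prodMk (hZ.prodMk (hξ t))).aemeasurable
    (measurable_utility_comp hv).aestronglyMeasurable

theorem worstCase_le_sum [ν.IsOpenPosMeasure] (hp : 0 < p)
    (hUc : ∀ t < T, ∀ h : Hist d t, IsCompact (U t h)) (hUm : ∀ t < T, IsRandomSet (U t))
    (hξ : ∀ i, Measurable (ξ i)) (hZ : ∀ t < T, Measurable (Z t))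
    {𝔲 : UtilitySeq p ν d} (h𝔲 : 𝔲 ∈ ambiguitySet T U)
    (hint : ∀ t < T, Integrable (fun ω => 𝔲 t (history ξ t ω) (Z t ω)) P)
    (hfin : ∀ t < T, ∫⁻ h, (Utility.stageInf (stageKernel P ξ Z t) Prod.fst (U t) h).toENNReal
      ∂P.map (history ξ t) ≠ ⊤) :
    worstCase P ξ Z T (ambiguitySet T U) ≤ ∑ t ∈ Finset.range T,
      (((∫⁻ h, (Utility.stageInf (stageKernel P ξ Z t) Prod.fst (U t) h).toENNReal
        ∂P.map (history ξ t) : ℝ≥0∞) : EReal) -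
      ((∫⁻ h, (-Utility.stageInf (stageKernel P ξ Z t) Prod.fst (U t) h).toENNReal
        ∂P.map (history ξ t) : ℝ≥0∞) : EReal)) := by
  refine EReal.le_sum_of_forall_coe_gt (fun t ht => EReal.sub_ne_top_of_ne_top (hfin t ht))
    fun r hr => ?_
  have hsel : ∀ t, ∃ v : Hist d t → Utility p ν, t < T →
      (Measurable fun q : Hist d t × ℝ => v q.1 q.2) ∧ (∀ h, v h ∈ U t h) ∧
      Integrable (fun ω => v (history ξ t ω) (Z t ω)) P ∧
      ∫ ω, v (history ξ t ω) (Z t ω) ∂P < r t := fun t => by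
    by_cases ht : t < T
    · have hprob : IsProbabilityMeasure (P.map (history ξ t)) :=
        Measure.isProbabilityMeasure_map (measurable_history hξ t).aemeasurable
      obtain ⟨v, hv, hvU, hvi, hvr⟩ := Utility.exists_selection_integral_lt hp (hUc t ht)
        (hUm t ht) (κ := stageKernel P ξ Z t) measurable_fst (h𝔲 t ht).1 (h𝔲 t ht).2
        ((integrable_stage_iff hξ (hZ t ht) (h𝔲 t ht).1).2 (hint t ht)) (hr t ht)
      exact ⟨v, fun _ => ⟨hv, hvU, (integrable_stage_iff hξ (hZ t ht) hv).1 hvi,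
        (integral_stage hξ (hZ t ht) hv).symm.trans_lt hvr⟩⟩
    · exact ⟨𝔲 t, fun h => absurd h ht⟩
  -- No constraint links different stages, so selections made separately form a member of the
  -- ambiguity set.
  choose 𝔳 h𝔳 using hsel
  have hmem : 𝔳 ∈ ambiguitySet T U := fun t ht => ⟨(h𝔳 t ht).1, (h𝔳 t ht).2.1⟩
  refine (iInf₂_le 𝔳 hmem).trans ?_
  have hi : ∀ t ∈ Finset.range T, Integrable (fun ω => 𝔳 t (history ξ t ω) (Z t ω)) P :=
    fun t ht => (h𝔳 t (Finset.mem_range.1 ht)).2.2.1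
  rw [extExpectation_coe (integrable_finsetSum _ hi), integral_finsetSum _ hi]
  exact EReal.coe_le_coe_iff.2 (Finset.sum_le_sum fun t ht =>
    (h𝔳 t (Finset.mem_range.1 ht)).2.2.2.le)

/-- A process with increments of nonnegative conditional mean has nonnegative terminal mean, as
soon as the positive part of the terminal value is integrable. -/
theorem integrable_sum_and_integral_nonneg (hξ : ∀ i, Measurable (ξ i))
    (hZ : ∀ t < T, Measurable (Z t))
    {w : ∀ t, Hist d t × (ℝ × EuclideanSpace ℝ (Fin (d t))) → ℝ}
    (hw : ∀ t < T, Measurable (w t))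
    (hadapted : ∀ t < T, ∃ g : Hist d (t + 1) → ℝ, Measurable g ∧
      ∀ ω, w t (history ξ t ω, (Z t ω, ξ t ω)) = g (history ξ (t + 1) ω))
    (hnonneg : ∀ t < T, ∀ᵐ h ∂P.map (history ξ t),
      Integrable (fun q => w t (h, q)) (stageKernel P ξ Z t h) ∧
        0 ≤ ∫ q, w t (h, q) ∂stageKernel P ξ Z t h)
    (hfin : ∫⁻ ω, ENNReal.ofReal
      (∑ t ∈ Finset.range T, w t (history ξ t ω, (Z t ω, ξ t ω))) ∂P ≠ ⊤) :
    Integrable (fun ω => ∑ t ∈ Finset.range T, w t (history ξ t ω, (Z t ω, ξ t ω))) P ∧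
      0 ≤ ∫ ω, ∑ t ∈ Finset.range T, w t (history ξ t ω, (Z t ω, ξ t ω)) ∂P := by
  set L : ℕ → Ω → ℝ := fun n ω =>
    ∑ t ∈ Finset.range n, w t (history ξ t ω, (Z t ω, ξ t ω)) with hL
  have hjoint : ∀ t < T, Measurable fun ω => (history ξ t ω, (Z t ω, ξ t ω)) := fun t ht =>
    (measurable_history hξ t).prodMk ((hZ t ht).prodMk (hξ t))
  -- Adaptedness makes the partial sum constant under the kernel at stage n, as the one-step
  -- inequality requires.
  have hfact : ∀ n ≤ T, ∃ c : Hist d n → ℝ, Measurable c ∧ ∀ ω, L n ω = c (history ξ n ω) := by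
    intro n hn
    choose! g hg hgeq using hadapted
    refine ⟨fun h => ∑ t : Fin n, g t (h.past (t + 1) t.2), ?_, fun ω => ?_⟩
    · exact Finset.measurable_sum _ fun t _ =>
        (hg t (by omega)).comp (Hist.measurable_past _)
    · simp only [hL]
      rw [Finset.sum_range]
      exact Finset.sum_congr rfl fun t _ => hgeq t (by omega) ω
  have step : ∀ n < T,
      ∫⁻ ω, ENNReal.ofReal (L n ω) ∂P ≤ ∫⁻ ω, ENNReal.ofReal (L (n + 1) ω) ∂P ∧
      ∫⁻ ω, ENNReal.ofReal (L n ω) ∂P + ∫⁻ ω, ENNReal.ofReal (-L (n + 1) ω) ∂P ≤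
        ∫⁻ ω, ENNReal.ofReal (-L n ω) ∂P + ∫⁻ ω, ENNReal.ofReal (L (n + 1) ω) ∂P := by
    intro n hn
    obtain ⟨c, hc, hLc⟩ := hfact n hn.le
    have hprob : IsProbabilityMeasure (P.map (history ξ n)) :=
      Measure.isProbabilityMeasure_map (measurable_history hξ n).aemeasurable
    have h := lintegral_ofReal_compProd_step hc (hw n hn) (hnonneg n hn)
    have hcw : Measurable fun q : Hist d n × (ℝ × EuclideanSpace ℝ (Fin (d n))) =>
      c q.1 + w n q := (hc.comp measurable_fst).add (hw n hn)
    have hcwn : Measurable fun q : Hist d n × (ℝ × EuclideanSpace ℝ (Fin (d n))) =>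
      -(c q.1 + w n q) := hcw.neg
    have hcn : Measurable fun h => -c h := hc.neg
    rw [map_history_compProd hξ (hZ n hn), lintegral_map hcw.ennreal_ofReal (hjoint n hn),
      lintegral_map hcwn.ennreal_ofReal (hjoint n hn),
      lintegral_map hc.ennreal_ofReal (measurable_history hξ n),
      lintegral_map hcn.ennreal_ofReal (measurable_history hξ n)] at h
    have hLs : ∀ ω, L (n + 1) ω =
        c (history ξ n ω) + w n (history ξ n ω, (Z n ω, ξ n ω)) := fun ω => by
      rw [← hLc]
      exact Finset.sum_range_succ _ _
    simpa only [hLc, hLs] using h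
  -- Integrability of positive parts travels backward from the terminal time; this finiteness then
  -- permits cancellation in the forward induction for the negative parts.
  have hmono : ∀ n ≤ T, ∫⁻ ω, ENNReal.ofReal (L n ω) ∂P ≠ ⊤ := by
    intro n hn
    induction hn using Nat.decreasingInduction with
    | self => exact hfin
    | of_succ n hn ih => exact ne_top_of_le_ne_top ih (step n hn).1
  have hneg : ∀ n ≤ T, ∫⁻ ω, ENNReal.ofReal (-L n ω) ∂P ≤ ∫⁻ ω, ENNReal.ofReal (L n ω) ∂P := by
    intro n hn
    induction n with
    | zero => simp [hL]
    | succ n ih =>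
      exact (ENNReal.add_le_add_iff_left (hmono n (by omega))).1
        ((step n (by omega)).2.trans (add_le_add (ih (by omega)) le_rfl))
  obtain ⟨c, hc, hLc⟩ := hfact T le_rfl
  have hLm : Measurable (L T) := by
    rw [funext hLc]
    exact hc.comp (measurable_history hξ T)
  have hint : Integrable (L T) P := integrable_of_lintegral_ofReal hLm hfin
    (ne_top_of_le_ne_top hfin (hneg T le_rfl))
  refine ⟨hint, ?_⟩
  rw [integral_eq_lintegral_pos_part_sub_lintegral_neg_part hint, sub_nonneg]
  exact ENNReal.toReal_mono hfin (hneg T le_rfl)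

end

/-! ### The lower bound for a single utility sequence -/

theorem EReal.ofReal_toReal_le (x : EReal) : ENNReal.ofReal x.toReal ≤ x.toENNReal := by
  by_cases hx : x = ⊤
  · simp [hx]
  · rw [EReal.toENNReal_of_ne_top hx]

theorem EReal.coe_finset_sum {ι : Type*} (s : Finset ι) (f : ι → ℝ) :
    ((∑ i ∈ s, f i : ℝ) : EReal) = ∑ i ∈ s, (f i : EReal) := by
  classical
  induction s using Finset.induction_on with
  | empty => simp
  | insert i s hi ih => rw [Finset.sum_insert hi, Finset.sum_insert hi, EReal.coe_add, ih]

section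

variable {p : ℝ≥0∞} {ν : Measure ℝ} {d : ℕ → ℕ} {Ω : Type*} [MeasurableSpace Ω] {P : Measure Ω}
  [IsProbabilityMeasure P] {ξ : ∀ i : ℕ, Ω → EuclideanSpace ℝ (Fin (d i))} {Z : ℕ → Ω → ℝ}
  {T : ℕ} {U : ∀ t : ℕ, Hist d t → Set (Utility p ν)}

theorem integrable_toReal_of_lintegral {α : Type*} [MeasurableSpace α] {μ : Measure α}
    {m : α → EReal} (hm : Measurable m) (h1 : ∫⁻ a, (m a).toENNReal ∂μ ≠ ⊤)
    (h2 : ∫⁻ a, (-m a).toENNReal ∂μ ≠ ⊤) : Integrable (fun a => (m a).toReal) μ := by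
  refine integrable_of_lintegral_ofReal hm.ereal_toReal
    (ne_top_of_le_ne_top h1 (lintegral_mono fun a => EReal.ofReal_toReal_le _))
    (ne_top_of_le_ne_top h2 (lintegral_mono fun a => ?_))
  rw [← EReal.toReal_neg_eq]
  exact EReal.ofReal_toReal_le _

theorem ae_ne_bot_ne_top_of_lintegral {α : Type*} [MeasurableSpace α] {μ : Measure α}
    {m : α → EReal} (hm : Measurable m) (h1 : ∫⁻ a, (m a).toENNReal ∂μ ≠ ⊤)
    (h2 : ∫⁻ a, (-m a).toENNReal ∂μ ≠ ⊤) : ∀ᵐ a ∂μ, m a ≠ ⊥ ∧ m a ≠ ⊤ := by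
  filter_upwards [ae_lt_top hm.ereal_toENNReal h1, ae_lt_top hm.neg.ereal_toENNReal h2]
    with a ha1 ha2
  refine ⟨fun h => ?_, fun h => ?_⟩
  · simp [h] at ha2
  · simp [h] at ha1

theorem coe_integral_toReal {α : Type*} [MeasurableSpace α] {μ : Measure α}
    {m : α → EReal} (hm : Measurable m) (h1 : ∫⁻ a, (m a).toENNReal ∂μ ≠ ⊤)
    (h2 : ∫⁻ a, (-m a).toENNReal ∂μ ≠ ⊤) :
    ((∫ a, (m a).toReal ∂μ : ℝ) : EReal) = ((∫⁻ a, (m a).toENNReal ∂μ : ℝ≥0∞) : EReal) -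
      ((∫⁻ a, (-m a).toENNReal ∂μ : ℝ≥0∞) : EReal) := by
  rw [EReal.coe_integral_eq_sub (integrable_toReal_of_lintegral hm h1 h2)]
  have hae := ae_ne_bot_ne_top_of_lintegral hm h1 h2
  congr 2
  · refine lintegral_congr_ae (hae.mono fun a ha => ?_)
    exact (EReal.toENNReal_of_ne_top ha.2).symm
  · refine lintegral_congr_ae (hae.mono fun a ha => ?_)
    dsimp only
    rw [← EReal.toReal_neg_eq]
    exact (EReal.toENNReal_of_ne_top fun h => ha.1 (EReal.neg_eq_top_iff.1 h)).symm

theorem sum_le_extExpectation (hξ : ∀ i, Measurable (ξ i))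
    (hZ : ∀ t < T, Measurable[MeasurableSpace.comap (history ξ (t + 1)) inferInstance] (Z t))
    (hm : ∀ t < T, Measurable (Utility.stageInf (stageKernel P ξ Z t) Prod.fst (U t)))
    (hfin : ∀ t < T, ∫⁻ h, (Utility.stageInf (stageKernel P ξ Z t) Prod.fst (U t) h).toENNReal
      ∂P.map (history ξ t) ≠ ⊤) {𝔲 : UtilitySeq p ν d} (h𝔲 : 𝔲 ∈ ambiguitySet T U) :
    ∑ t ∈ Finset.range T,
      (((∫⁻ h, (Utility.stageInf (stageKernel P ξ Z t) Prod.fst (U t) h).toENNReal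
        ∂P.map (history ξ t) : ℝ≥0∞) : EReal) -
      ((∫⁻ h, (-Utility.stageInf (stageKernel P ξ Z t) Prod.fst (U t) h).toENNReal
        ∂P.map (history ξ t) : ℝ≥0∞) : EReal)) ≤
    extExpectation P
      (fun ω => ((∑ t ∈ Finset.range T, 𝔲 t (history ξ t ω) (Z t ω) : ℝ) : EReal)) := by
  set m : ∀ t, Hist d t → EReal := fun t =>
    Utility.stageInf (stageKernel P ξ Z t) Prod.fst (U t)
  by_cases hS : ∫⁻ ω, ENNReal.ofReal (∑ t ∈ Finset.range T, 𝔲 t (history ξ t ω) (Z t ω)) ∂P = ⊤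
  · exact le_top.trans_eq (if_pos hS).symm
  -- One stage with E[m_t] = -∞ makes the left side ⊥. Otherwise every m_t is integrable and almost
  -- surely finite.
  by_cases hB : ∃ t ∈ Finset.range T, ∫⁻ h, (-m t h).toENNReal ∂P.map (history ξ t) = ⊤
  · rw [EReal.sum_sub_of_ne_top _ fun t ht => hfin t (Finset.mem_range.1 ht),
      ENNReal.sum_eq_top.2 hB]
    simp
  push Not at hB
  have hZm : ∀ t < T, Measurable (Z t) := fun t ht =>
    (hZ t ht).mono (measurable_history hξ (t + 1)).comap_le le_rfl
  have hneg : ∀ t < T, ∫⁻ h, (-m t h).toENNReal ∂P.map (history ξ t) ≠ ⊤ := fun t ht =>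
    hB t (Finset.mem_range.2 ht)
  have hmr : ∀ t < T, Measurable fun h => (m t h).toReal := fun t ht => (hm t ht).ereal_toReal
  have hmi : ∀ t ∈ Finset.range T, Integrable (fun ω => (m t (history ξ t ω)).toReal) P :=
    fun t ht => by
      rw [Finset.mem_range] at ht
      exact (integrable_toReal_of_lintegral (hm t ht) (hfin t ht) (hneg t ht)).comp_measurable
        (measurable_history hξ t)
  have hMi := integrable_finsetSum _ hmi
  let w : ∀ t, Hist d t × (ℝ × EuclideanSpace ℝ (Fin (d t))) → ℝ :=
    fun t q => 𝔲 t q.1 q.2.1 - (m t q.1).toReal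
  have hsum : ∀ ω, ∑ t ∈ Finset.range T, w t (history ξ t ω, (Z t ω, ξ t ω)) =
      ∑ t ∈ Finset.range T, 𝔲 t (history ξ t ω) (Z t ω) -
        ∑ t ∈ Finset.range T, (m t (history ξ t ω)).toReal := fun ω => Finset.sum_sub_distrib ..
  have hmain := integrable_sum_and_integral_nonneg (P := P) (ξ := ξ) (Z := Z) (T := T) (w := w)
    hξ hZm
    (fun t ht => (measurable_utility_comp (h𝔲 t ht).1).sub ((hmr t ht).comp measurable_fst))
    (fun t ht => by
      -- The reward is a measurable function of the history through its own stage, so the increment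
      -- is adapted.
      obtain ⟨ζ, hζ, hζeq⟩ := (hZ t ht).exists_eq_measurable_comp
      refine ⟨fun h => 𝔲 t (h.past t t.le_succ) (ζ h) - (m t (h.past t t.le_succ)).toReal,
        ((h𝔲 t ht).1.comp ((Hist.measurable_past _).prodMk hζ)).sub
          ((hmr t ht).comp (Hist.measurable_past _)), fun ω => ?_⟩
      simp only [w, past_history, congrFun hζeq ω, Function.comp_apply])
    (fun t ht => by
      filter_upwards [ae_ne_bot_ne_top_of_lintegral (hm t ht) (hfin t ht) (hneg t ht)] with h hh
      have hi : Integrable (fun q : ℝ × EuclideanSpace ℝ (Fin (d t)) => 𝔲 t h q.1)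
        (stageKernel P ξ Z t h) := (𝔲 t h).integrable_comp _ measurable_fst
      refine ⟨hi.sub (integrable_const (m t h).toReal), ?_⟩
      simp only [w]
      rw [integral_sub hi (integrable_const _)]
      simp only [integral_const, probReal_univ, one_smul, sub_nonneg]
      rw [← EReal.coe_le_coe_iff, EReal.coe_toReal hh.2 hh.1]
      exact Utility.stageInf_le ((h𝔲 t ht).2 h))
    (by
      -- The terminal positive part is at most that of the total utility plus the negative part of
      -- the integrable sum of the m_t.
      refine ne_top_of_le_ne_top (ENNReal.add_ne_top.2 ⟨hS, hMi.neg.lintegral_lt_top.ne⟩)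
        ((lintegral_mono fun ω => ?_).trans_eq (lintegral_add_right' _
          hMi.neg.aestronglyMeasurable.aemeasurable.ennreal_ofReal))
      rw [hsum, sub_eq_add_neg]
      exact ENNReal.ofReal_add_le)
  simp only [hsum] at hmain
  obtain ⟨hint, h0⟩ := hmain
  have hSi : Integrable (fun ω => ∑ t ∈ Finset.range T, 𝔲 t (history ξ t ω) (Z t ω)) P := by
    refine (hint.add hMi).congr (ae_of_all _ fun ω => ?_)
    simp
  rw [integral_sub hSi hMi, sub_nonneg, integral_finsetSum _ hmi] at h0
  rw [extExpectation_coe hSi]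
  refine le_of_eq_of_le ?_ (EReal.coe_le_coe_iff.2 h0)
  rw [EReal.coe_finset_sum]
  refine Finset.sum_congr rfl fun t ht => ?_
  rw [Finset.mem_range] at ht
  rw [← coe_integral_toReal (hm t ht) (hfin t ht) (hneg t ht),
    integral_map (measurable_history hξ t).aemeasurable (hmr t ht).aestronglyMeasurable]

end

/-! ### Rectangularity of the ambiguity set -/

theorem mainTheorem1
    {p : ℝ≥0∞} (hp : 0 < p) (ν : Measure ℝ) [ν.IsOpenPosMeasure]
    (d : ℕ → ℕ) (T : ℕ)
    (U : ∀ t : ℕ, Hist d t → Set (Utility p ν))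
    (hU_compact : ∀ t < T, ∀ h : Hist d t, IsCompact (U t h))
    (hU_measurable : ∀ t < T, IsRandomSet (U t))
    {Ω : Type*} [MeasurableSpace Ω] (P : Measure Ω) [IsProbabilityMeasure P]
    (ξ : ∀ i : ℕ, Ω → EuclideanSpace ℝ (Fin (d i))) (hξ : ∀ i, Measurable (ξ i))
    (Z : ℕ → Ω → ℝ)
    (hZ : ∀ t < T, Measurable[MeasurableSpace.comap (history ξ (t + 1)) inferInstance] (Z t))
    (h_int : ∃ 𝔲 ∈ ambiguitySet T U, ∀ t < T,
      Integrable (fun ω => 𝔲 t (history ξ t ω) (Z t ω)) P) :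
    (∀ 𝔲 ∈ ambiguitySet T U, ∀ t < T, ∀ h : Hist d t,
      stageSet (ambiguitySet T U) t (fun s => 𝔲 s (h.past s s.isLt.le)) h = U t h) ∧
    IsRectangular P ξ Z T (ambiguitySet T U) ∧
    worstCase P ξ Z T (ambiguitySet T U) =
      nestedValue P ξ Z (fun t _ h => U t h) T 0 Fin.elim0 (fun i => i.elim0) := by
  obtain ⟨𝔲, h𝔲, hint⟩ := h_int
  have hZm : ∀ t < T, Measurable (Z t) := fun t ht =>
    (hZ t ht).mono (measurable_history hξ (t + 1)).comap_le le_rfl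
  have hm : ∀ t < T, Measurable (Utility.stageInf (stageKernel P ξ Z t) Prod.fst (U t)) :=
    fun t ht => Utility.measurable_stageInf hp (hU_compact t ht) (hU_measurable t ht)
      measurable_fst (h𝔲 t ht).1 (h𝔲 t ht).2
  have hfin : ∀ t < T, ∫⁻ h, (Utility.stageInf (stageKernel P ξ Z t) Prod.fst (U t) h).toENNReal
      ∂P.map (history ξ t) ≠ ⊤ := fun t ht => by
    have hprob : IsProbabilityMeasure (P.map (history ξ t)) :=
      Measure.isProbabilityMeasure_map (measurable_history hξ t).aemeasurable
    have h1 := ((integrable_stage_iff hξ (hZm t ht) (h𝔲 t ht).1).2 (hint t ht)).2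
    rw [HasFiniteIntegral,
      Measure.lintegral_compProd (measurable_utility_comp (h𝔲 t ht).1).enorm] at h1
    exact ne_top_of_le_ne_top h1.ne
      (lintegral_mono fun h => Utility.toENNReal_stageInf_le ((h𝔲 t ht).2 h))
  have heq : worstCase P ξ Z T (ambiguitySet T U) =
      nestedValue P ξ Z (fun t _ h => U t h) T 0 Fin.elim0 (fun i => i.elim0) := by
    rw [nestedValue_zero_eq_sum hξ hZm (fun t ht h => ⟨_, (h𝔲 t ht).2 h⟩) hm hfin]
    exact le_antisymm (worstCase_le_sum hp hU_compact hU_measurable hξ hZm h𝔲 hint hfin)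
      (le_iInf₂ fun 𝔳 h𝔳 => sum_le_extExpectation hξ hZ hm hfin h𝔳)
  refine ⟨fun 𝔳 h𝔳 t ht h => stageSet_ambiguitySet h𝔳 ht h, ⟨⟨𝔲, h𝔲⟩, ?_⟩, heq⟩
  rw [heq]
  exact (nestedValue_stageSet_ambiguitySet P ξ Z (zero_add T) h𝔲 _ fun s => s.elim0).symm
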